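/- Let $n\ge 2$, write $|x|=\max_j|x_j|$ for $x\in\mathbb R^n$ and $x\cdot y$ for the standard scalar product. Let $\alpha\in\mathbb R^n\setminus\{0\}$, and fix an index $i_0$ with $|\alpha_{i_0}|=|\alpha|$. A real subspace of $\mathbb R^n$ is called rational if it has a basis of vectors in $\mathbb Q^n$; let $F$ be the smallest rational subspace containing $\alpha$, let $d=\dim F$ (the number of effective frequencies of $\alpha$), let $\Lambda=\mathbb Z^n\cap F$, and let $\det\Lambda$ be the absolute value of the determinant of a $\mathbb Z$-basis of $\Lambda$ with respect to an orthonormal basis of $F$ (for the Euclidean structure induced by $\mathbb R^n$). For $1\le k\le d$: - for $Q\ge 1$, $\Psi_k(Q)$ is the infimum of the set of $K>0$ such that there exist $k$ linearly independent vectors $x\in\Lambda$ with $|x|\le K$ and $|x_{i_0}\alpha-\alpha_{i_0}x|\le Q^{-1}$; - $C'_k$ is the least integer $q\ge1$ such that there exist $k$ linearly independent vectors $x\in\Lambda$ with $|x|\le q$; - for real $Q$, $\Psi'_k(Q)$ is the supremum of the set of $K>0$ such that there exist $k$ linearly independent vectors $x\in\Lambda$ with $|x|\le Q$ and $|x\cdot\alpha|\le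 K^{-1}$; it is meant for $Q\ge C'_k$, and for $Q<C'_k$, when this set is empty, we put $\Psi'_k(Q)=0$. Let $1\le k\le d$. Then $\Psi_k(Q)$ is well defined for every $Q\ge 1$ (the set is non-empty, and the infimum is a minimum; in particular $\Psi_k(Q)>0$), and $\Psi'_k(Q)$ is well defined for every $Q\ge C'_k$ (the set is non-empty and bounded, and the supremum is a maximum). Moreover put $$c_1=(n+1)^{-1}|\alpha|,\quad c_2=(n+2)^{-1}|\alpha|,\quad c_3=(\det\Lambda)^2\,d!\,|\alpha|,\quad c_4=2c_3,$$ and $Q_0=\max\bigl(1,(n+2)C'_j|\alpha|^{-1}\bigr)$, where $j$ is either of the two indices $k$ and $d+1-k$. Then for every $Q\ge Q_0$ $$c_1\Psi'_{d+1-k}(c_2Q)\le\Psi_k(Q)\le c_3\Psi'_{d+1-k}(c_4Q).$$ -/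

import Mathlib

open Module

noncomputable section

namespace DioDuality

/-- The sup norm `|x| = max_j |x_j|` on `ℝⁿ`. (The norm `‖x‖` of `EuclideanSpace` is the Euclidean
one.) -/
def supNorm {n : ℕ} (x : EuclideanSpace ℝ (Fin n)) : ℝ := ‖(WithLp.ofLp x : Fin n → ℝ)‖

/-- A real subspace of `ℝⁿ` is rational if it has a basis of vectors in `ℚⁿ`. -/
def IsRational {n : ℕ} (W : Submodule ℝ (EuclideanSpace ℝ (Fin n))) : Prop :=
  ∃ (m : ℕ) (b : Basis (Fin m) ℝ W), ∀ i j, ∃ q : ℚ, (b i : EuclideanSpace ℝ (Fin n)) j = q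

/-- The rational hull `F` of `α`: the smallest rational subspace of `ℝⁿ` containing `α`
(`isLeast_rationalHull` below shows that it is one). -/
def rationalHull {n : ℕ} (α : EuclideanSpace ℝ (Fin n)) :
    Submodule ℝ (EuclideanSpace ℝ (Fin n)) :=
  sInf {W | IsRational W ∧ α ∈ W}

/-- The number `d` of effective frequencies of `α`. -/
def effFreq {n : ℕ} (α : EuclideanSpace ℝ (Fin n)) : ℕ := finrank ℝ (rationalHull α)

/-- The lattice `Λ = ℤⁿ ∩ F`, as a `ℤ`-submodule of `F`. -/
def hullLattice {n : ℕ} (α : EuclideanSpace ℝ (Fin n)) : Submodule ℤ (rationalHull α) where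
  carrier := {x | ∀ j, ∃ m : ℤ, (x : EuclideanSpace ℝ (Fin n)) j = m}
  zero_mem' := fun j => ⟨0, by simp⟩
  add_mem' := fun {x y} hx hy j => by
    obtain ⟨a, ha⟩ := hx j
    obtain ⟨b, hb⟩ := hy j
    exact ⟨a + b, by simp [ha, hb]⟩
  smul_mem' := fun c x hx j => by
    obtain ⟨a, ha⟩ := hx j
    exact ⟨c * a, by simp [ha]⟩

/-! ### The rational hull is rational, and `Λ` is a lattice in it -/

/-- Applying a `ℚ`-linear map `ℝ → ℚ` to all coordinates. -/
def coordMap {n : ℕ} (φ : ℝ →ₗ[ℚ] ℚ) (x : EuclideanSpace ℝ (Fin n)) :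
    EuclideanSpace ℝ (Fin n) :=
  WithLp.toLp 2 fun j => ((φ (x j) : ℚ) : ℝ)

theorem IsRational.coordMap_mem {n : ℕ} {W : Submodule ℝ (EuclideanSpace ℝ (Fin n))}
    (hW : IsRational W) (φ : ℝ →ₗ[ℚ] ℚ) {x : EuclideanSpace ℝ (Fin n)} (hx : x ∈ W) :
    coordMap φ x ∈ W := by
  obtain ⟨m, b, hb⟩ := hW
  choose q hq using hb
  have key : coordMap φ x =
      ∑ i, ((φ (b.repr ⟨x, hx⟩ i) : ℚ) : ℝ) • (b i : EuclideanSpace ℝ (Fin n)) := by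
    have h0 : x = ∑ i, b.repr ⟨x, hx⟩ i • (b i : EuclideanSpace ℝ (Fin n)) := by
      have h := congrArg W.subtype (b.sum_repr ⟨x, hx⟩)
      rw [map_sum] at h
      exact h.symm
    ext j
    have h1 : x j = ∑ i, q i j • b.repr ⟨x, hx⟩ i := by
      conv_lhs => rw [h0]
      simp [hq, Rat.smul_def, mul_comm]
    simp only [coordMap]
    rw [h1, map_sum]
    simp [hq, mul_comm]
  rw [key]
  exact Submodule.sum_mem _ fun i _ => W.smul_mem _ (b i).2

/-- If `W` is stable under all the maps `coordMap φ`, it is spanned by its rational vectors. -/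
theorem mem_span_rational {n : ℕ} {W : Submodule ℝ (EuclideanSpace ℝ (Fin n))}
    (hW : ∀ (φ : ℝ →ₗ[ℚ] ℚ) (x : EuclideanSpace ℝ (Fin n)), x ∈ W → coordMap φ x ∈ W)
    {x : EuclideanSpace ℝ (Fin n)} (hx : x ∈ W) :
    x ∈ Submodule.span ℝ {y : EuclideanSpace ℝ (Fin n) | y ∈ W ∧ ∀ j, ∃ q : ℚ, y j = q} := by
  classical
  let B := Basis.ofVectorSpace ℚ ℝ
  let s := Finset.univ.biUnion fun j : Fin n => (B.repr (x j)).support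
  have key : x = ∑ i ∈ s, (B i) • coordMap (B.coord i) x := by
    ext j
    have h := B.linearCombination_repr (x j)
    rw [Finsupp.linearCombination_apply, Finsupp.sum_of_support_subset (s := s) _
      (Finset.subset_biUnion_of_mem (fun j : Fin n => (B.repr (x j)).support) (Finset.mem_univ j))
      _ (by simp)] at h
    conv_lhs => rw [← h]
    simp [coordMap, Rat.smul_def, mul_comm]
  rw [key]
  refine Submodule.sum_mem _ fun i _ => Submodule.smul_mem _ _ (Submodule.subset_span ⟨?_, ?_⟩)
  · exact hW _ _ hx
  · exact fun j => ⟨B.coord i (x j), rfl⟩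

theorem coordMap_mem_rationalHull {n : ℕ} (α : EuclideanSpace ℝ (Fin n)) (φ : ℝ →ₗ[ℚ] ℚ)
    (x : EuclideanSpace ℝ (Fin n)) (hx : x ∈ rationalHull α) :
    coordMap φ x ∈ rationalHull α := by
  simp only [rationalHull, Submodule.mem_sInf] at hx ⊢
  exact fun W hW => hW.1.coordMap_mem φ (hx W hW)

theorem span_rational_rationalHull {n : ℕ} (α : EuclideanSpace ℝ (Fin n)) :
    Submodule.span ℝ {y : rationalHull α |
      ∀ j, ∃ q : ℚ, (y : EuclideanSpace ℝ (Fin n)) j = q} = ⊤ := by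
  rw [eq_top_iff]
  rintro ⟨x, hx⟩ -
  have h := mem_span_rational (coordMap_mem_rationalHull α) hx
  have himg : {y : EuclideanSpace ℝ (Fin n) | y ∈ rationalHull α ∧ ∀ j, ∃ q : ℚ, y j = q} =
      (rationalHull α).subtype '' {y : rationalHull α |
        ∀ j, ∃ q : ℚ, (y : EuclideanSpace ℝ (Fin n)) j = q} := by
    ext y
    constructor
    · rintro ⟨h1, h2⟩
      exact ⟨⟨y, h1⟩, h2, rfl⟩
    · rintro ⟨z, hz, rfl⟩
      exact ⟨z.2, hz⟩
  rw [himg, Submodule.span_image] at h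
  obtain ⟨z, hz, hzx⟩ := h
  have : z = ⟨x, hx⟩ := Subtype.ext hzx
  rwa [← this]

theorem isRational_rationalHull {n : ℕ} (α : EuclideanSpace ℝ (Fin n)) :
    IsRational (rationalHull α) := by
  obtain ⟨b, hb, hspan, hli⟩ := exists_linearIndependent ℝ {y : rationalHull α |
      ∀ j, ∃ q : ℚ, (y : EuclideanSpace ℝ (Fin n)) j = q}
  rw [span_rational_rationalHull] at hspan
  let B : Basis b ℝ (rationalHull α) := Basis.mk hli (by simp [hspan])
  have : Fintype b := FiniteDimensional.fintypeBasisIndex B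
  refine ⟨_, B.reindex (Fintype.equivFin b), fun i j => ?_⟩
  have := hb ((Fintype.equivFin b).symm i).2 j
  simpa [B] using this

theorem isLeast_rationalHull {n : ℕ} (α : EuclideanSpace ℝ (Fin n)) :
    IsLeast {W | IsRational W ∧ α ∈ W} (rationalHull α) :=
  ⟨⟨isRational_rationalHull α, by
    simp only [rationalHull, Submodule.mem_sInf]
    exact fun W hW => hW.2⟩, fun _ hW => sInf_le hW⟩

instance discreteTopology_hullLattice {n : ℕ} (α : EuclideanSpace ℝ (Fin n)) :
    DiscreteTopology (hullLattice α) := by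
  rw [discreteTopology_iff_isOpen_singleton_zero, Metric.isOpen_singleton_iff]
  refine ⟨1, one_pos, fun y hy => ?_⟩
  ext j
  obtain ⟨m, hm⟩ := y.2 j
  have h1 : |((y : rationalHull α) : EuclideanSpace ℝ (Fin n)) j| < 1 := by
    refine lt_of_le_of_lt ?_ (by simpa [dist_zero_right] using hy)
    exact PiLp.norm_apply_le ((y : rationalHull α) : EuclideanSpace ℝ (Fin n)) j
  rw [hm] at h1
  have h2 : m = 0 := by
    have h3 : ((|m| : ℤ) : ℝ) < ((1 : ℤ) : ℝ) := by
      rw [Int.cast_abs, Int.cast_one]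
      exact h1
    exact Int.abs_lt_one_iff.mp (Int.cast_lt.mp h3)
  simp [hm, h2]

instance isZLattice_hullLattice {n : ℕ} (α : EuclideanSpace ℝ (Fin n)) :
    IsZLattice ℝ (hullLattice α) where
  span_top := by
    rw [eq_top_iff, ← span_rational_rationalHull α, Submodule.span_le]
    intro y hy
    choose q hq using hy
    let D : ℕ := ∏ j, (q j).den
    have hD : (D : ℝ) ≠ 0 := by
      simp [D, Finset.prod_ne_zero_iff]
    have hmem : (D : ℝ) • y ∈ hullLattice α := by
      intro j
      obtain ⟨c, hc⟩ := Finset.dvd_prod_of_mem (fun j => (q j).den) (Finset.mem_univ j)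
      refine ⟨c * (q j).num, ?_⟩
      have h1 : ((q j).den : ℝ) * (q j : ℝ) = (q j).num := by
        exact_mod_cast Rat.den_mul_eq_num (q j)
      have h2 : (D : ℝ) = (q j).den * c := by exact_mod_cast hc
      simp only [Submodule.coe_smul, PiLp.smul_apply, smul_eq_mul, hq, h2]
      push_cast
      rw [← h1]
      ring
    have : y = (D : ℝ)⁻¹ • ((D : ℝ) • y) := by
      rw [smul_smul, inv_mul_cancel₀ hD, one_smul]
    rw [this]
    exact Submodule.smul_mem _ _ (Submodule.subset_span hmem)

/-- The determinant of a lattice `L` in a Euclidean space `V`: the absolute value of the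
determinant of a `ℤ`-basis of `L` with respect to an orthonormal basis of `V` (it does not depend on
the two bases). -/
def latticeDet {V : Type*} [NormedAddCommGroup V] [InnerProductSpace ℝ V] [FiniteDimensional ℝ V]
    (L : Submodule ℤ V) [DiscreteTopology L] [IsZLattice ℝ L] : ℝ :=
  haveI := ZLattice.module_finite ℝ L
  haveI := ZLattice.module_free ℝ L
  |(stdOrthonormalBasis ℝ V).toBasis.det
    fun i => (Module.finBasisOfFinrankEq ℤ L (ZLattice.rank ℝ L) i : V)|

/-! ### The functions `Ψ_k` and `Ψ'_k` -/

/-- The set of `K > 0` such that there are `k` linearly independent `x ∈ ℤⁿ ∩ F` with `|x| ≤ K` and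
`|x_{i₀} α - α_{i₀} x| ≤ Q⁻¹`. -/
def psiSet {n : ℕ} (α : EuclideanSpace ℝ (Fin n)) (i₀ : Fin n) (k : ℕ) (Q : ℝ) : Set ℝ :=
  {K | 0 < K ∧ ∃ x : Fin k → rationalHull α, LinearIndependent ℝ x ∧
    ∀ i, x i ∈ hullLattice α ∧
      supNorm (x i : EuclideanSpace ℝ (Fin n)) ≤ K ∧
      supNorm ((x i : EuclideanSpace ℝ (Fin n)) i₀ • α -
        α i₀ • (x i : EuclideanSpace ℝ (Fin n))) ≤ Q⁻¹}

/-- `Ψ_k(Q)`. -/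
def psi {n : ℕ} (α : EuclideanSpace ℝ (Fin n)) (i₀ : Fin n) (k : ℕ) (Q : ℝ) : ℝ :=
  sInf (psiSet α i₀ k Q)

/-- `C'_k`: the least integer `q ≥ 1` such that there are `k` linearly independent `x ∈ ℤⁿ ∩ F`
with `|x| ≤ q`. -/
def cPrime {n : ℕ} (α : EuclideanSpace ℝ (Fin n)) (k : ℕ) : ℕ :=
  sInf {q : ℕ | 1 ≤ q ∧ ∃ x : Fin k → rationalHull α, LinearIndependent ℝ x ∧
    ∀ i, x i ∈ hullLattice α ∧ supNorm (x i : EuclideanSpace ℝ (Fin n)) ≤ q}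

/-- The set of `K > 0` such that there are `k` linearly independent `x ∈ ℤⁿ ∩ F` with `|x| ≤ Q` and
`|x · α| ≤ K⁻¹`. -/
def psiPrimeSet {n : ℕ} (α : EuclideanSpace ℝ (Fin n)) (k : ℕ) (Q : ℝ) : Set ℝ :=
  {K | 0 < K ∧ ∃ x : Fin k → rationalHull α, LinearIndependent ℝ x ∧
    ∀ i, x i ∈ hullLattice α ∧
      supNorm (x i : EuclideanSpace ℝ (Fin n)) ≤ Q ∧
      |inner ℝ (x i : EuclideanSpace ℝ (Fin n)) α| ≤ K⁻¹}

/-- `Ψ'_k(Q)`, meant for `Q ≥ C'_k`; for `Q < C'_k` it is the supremum of the empty set of positive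
numbers, which is `0`. -/
def psiPrime {n : ℕ} (α : EuclideanSpace ℝ (Fin n)) (k : ℕ) (Q : ℝ) : ℝ :=
  sSup (psiPrimeSet α k Q)

end DioDuality

end

/-!
The theorem is a transference statement between the body
`C_K = {x ∈ F : |x| ≤ K, |x_{i₀} α - α_{i₀} x| ≤ Q⁻¹}` and its polar body.

**Lower bound for `Ψ_k`** (`supNorm_mul_le_of_pairing`). Take `k` independent lattice points `x`
realising `Ψ_k(Q)` and `d + 1 - k` independent lattice points `y` realising `Ψ'_{d+1-k}(c₂ Q)`.
Since `k + (d + 1 - k) > d`, some `x · y` is nonzero, hence an integer of absolute value at least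
`1`, and `α_{i₀} (x · y) = x_{i₀} (α · y) - (x_{i₀} α - α_{i₀} x) · y` bounds it from above.

**Upper bound for `Ψ_k`** (`exists_dual_vectors_of_lowerBound_psiSet`). For `K = Ψ_k(Q)` the `k`-th
successive minimum of `C_K` is at least `1`. Mahler's transference theorem with the constant `d!`
(`exists_dual_lattice_vectors`) gives `d + 1 - k` independent vectors `y` of the dual lattice with
`|y · x| ≤ d!` on `C_K`. Evaluating at `α` and at the orthogonal projections to `F` of
the coordinate vectors bounds `|y · α|` and `|y|`; the factor `(det Λ)²`, a Gram determinant, brings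
`y` back into `Λ` (`latticeDet_sq_smul_mem`).

Mahler's theorem is derived from Minkowski's second theorem as follows. Let `a₁, …, a_d` be lattice
points realising the successive minima `λ₁ ≤ … ≤ λ_d` of a symmetric convex body `C`, let `a_j^*` be
the coordinate functionals of this basis, and let `I` be the index in `Λ` of the lattice that the
`a_i` span. Then `I a_j^*` is integral on `Λ`. If `x ∈ C`, then `C` contains the cross-polytope with
vertices `± x` and `± a_i / λ_i` for `i ≠ j`; its volume is
`(2^d / d!) |a_j^*(x)| I det Λ / ∏_{i ≠ j} λ_i`, while `vol C ≤ 2^d det Λ / ∏ λ_i` by Minkowski.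
Hence `|I a_j^*(x)| ≤ d! / λ_j` (`abs_apply_mul_le_factorial_mul_det`), which is at most `d!` for
`j ≥ k` if `λ_k ≥ 1`.

Minkowski's second theorem (`prod_mul_volume_le_volume_fundamentalDomain`) is proved by carrying a
set `B` whose points are pairwise incongruent modulo `Λ` from `λ_i • K` to `λ_{i+1} • K`, where
`K = C / 2`, while its volume grows by the factor `(λ_{i+1} / λ_i)^(d - i)`
(`exists_packing_expand`). In the end `B` has volume `∏ λ_i · vol K`, which is at most `det Λ`.

The same transference argument as `K → ∞` shows that `Ψ_k(Q)` is finite: `y · α ≠ 0` for nonzero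
`y ∈ Λ`, because otherwise `y^⊥` would be a rational subspace that contains `α`, hence `F`, but not
`y`.
-/

noncomputable section

namespace DioDuality

open scoped Pointwise

/-! ### Minkowski's second theorem -/

open MeasureTheory in
/-- Let `B` be a subset of an open convex set `M` whose points are pairwise incongruent modulo `L`,
and suppose that points of `t • M` congruent modulo `L` agree in the coordinates `≥ i`. Then `t • M`
contains a set with pairwise incongruent points whose volume is `t ^ (d - i)` times that of `B`.

The coordinates `≥ i` of `x ∈ B` are multiplied by `t`, and its coordinates `< i` are translated by
`(t - 1) u`, where `u` depends only on the coordinates `≥ i` of `x` and is such that the point with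
coordinates `u` below `i`, and those of `x` from `i` on, lies in `M`. By convexity the result lies
in `t • M`, and the map preserves incongruence because it is a translation on each fibre. Choosing
`u` from a countable dense sequence makes the map piecewise affine, so that volumes of images are
immediate. -/
theorem exists_packing_expand {d : ℕ} {M B : Set (Fin d → ℝ)} (hMo : IsOpen M)
    (hMc : Convex ℝ M) (hBM : B ⊆ M) (hB : MeasurableSet B) {t : ℝ} (ht : 1 ≤ t) (i : ℕ)
    (L : AddSubgroup (Fin d → ℝ)) (hpack : ∀ x ∈ B, ∀ y ∈ B, x - y ∈ L → x = y)
    (hL : ∀ x ∈ M, ∀ y ∈ M, t • x - t • y ∈ L → ∀ j : Fin d, i ≤ j → x j = y j) :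
    ∃ B' : Set (Fin d → ℝ), (∀ z ∈ B', ∃ x ∈ M, z = t • x) ∧ MeasurableSet B' ∧
      (∀ x ∈ B', ∀ y ∈ B', x - y ∈ L → x = y) ∧
      volume B' = ENNReal.ofReal (t ^ (d - i)) * volume B := by
  classical
  have ht0 : 0 < t := by linarith
  let u : ℕ → Fin d → ℝ := TopologicalSpace.denseSeq _
  -- `c v x` has the coordinates of `v` below `i` and those of `x` from `i` on.
  let c : (Fin d → ℝ) → (Fin d → ℝ) → Fin d → ℝ := fun v x j => if (j : ℕ) < i then v j else x j
  have hc2 : ∀ v, Continuous (c v) := fun v => continuous_pi fun j => by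
    by_cases h : (j : ℕ) < i <;> simp only [c, h, if_true, if_false] <;> fun_prop
  have hc1 : ∀ x, Continuous fun v => c v x := fun x => continuous_pi fun j => by
    by_cases h : (j : ℕ) < i <;> simp only [c, h, if_true, if_false] <;> fun_prop
  -- The piece `P n` consists of the `x` for which `u n` is the first admissible translation.
  let P : ℕ → Set (Fin d → ℝ) := fun n => {x | c (u n) x ∈ M ∧ ∀ m < n, c (u m) x ∉ M}
  have hE : ∀ n, MeasurableSet {x | c (u n) x ∈ M} := fun n =>
    (hMo.preimage (hc2 _)).measurableSet
  have hP : ∀ n, MeasurableSet (P n) := fun n => by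
    have : P n = {x | c (u n) x ∈ M} ∩ ⋂ m, ⋂ _ : m < n, {x | c (u m) x ∈ M}ᶜ := by
      ext x; simp [P]
    rw [this]
    exact (hE n).inter (MeasurableSet.iInter fun m => MeasurableSet.iInter fun _ => (hE m).compl)
  have hex : ∀ x ∈ M, ∃ n, x ∈ P n := fun x hx => by
    have h1 : ∃ n, c (u n) x ∈ M := by
      obtain ⟨n, hv⟩ := (TopologicalSpace.denseRange_denseSeq (Fin d → ℝ)).exists_mem_open
        (hMo.preimage (hc1 x)) ⟨x, by
          have : c x x = x := by ext j; simp [c]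
          simpa [this] using hx⟩
      exact ⟨_, hv⟩
    exact ⟨Nat.find h1, Nat.find_spec h1, fun m hm => Nat.find_min h1 hm⟩
  have hPuniq : ∀ {m n : ℕ} {x y : Fin d → ℝ}, x ∈ P m → y ∈ P n →
      (∀ j : Fin d, i ≤ j → x j = y j) → m = n := fun {m n x y} hx hy hxy => by
    have hcc : ∀ v, c v x = c v y := fun v => by
      ext j
      by_cases h : (j : ℕ) < i
      · simp [c, h]
      · simp [c, h, hxy j (not_lt.mp h)]
    rcases lt_trichotomy m n with h | h | h
    · exact absurd (hcc _ ▸ hx.1) (hy.2 m h)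
    · exact h
    · exact absurd (hcc (u n) ▸ hy.1) (hx.2 n h)
  let w : Fin d → ℝ := fun j => if (j : ℕ) < i then 1 else t
  let g : (Fin d → ℝ) →ₗ[ℝ] (Fin d → ℝ) := Matrix.toLin' (Matrix.diagonal w)
  have hg : ∀ x j, g x j = w j * x j := fun x j => by simp [g, Matrix.mulVec_diagonal]
  have hdet : LinearMap.det g = t ^ (d - i) := by
    have h1 : LinearMap.det g = ∏ j : Fin d, (if (j : ℕ) < i then 1 else t) := by
      simp [g, w, LinearMap.det_toLin']
    rw [h1, Fin.prod_univ_eq_prod_range (fun j => if j < i then 1 else t) d]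
    rw [Finset.prod_ite]
    simp only [Finset.prod_const_one, one_mul, Finset.prod_const]
    congr 1
    have : Finset.filter (fun x => ¬ x < i) (Finset.range d) = Finset.Ico i d := by
      ext; simp; tauto
    rw [this, Nat.card_Ico]
  let T : ℕ → Fin d → ℝ := fun n j => if (j : ℕ) < i then (t - 1) * u n j else 0
  let f : ℕ → (Fin d → ℝ) → (Fin d → ℝ) := fun n x => T n + g x
  have hfM : ∀ n x, x ∈ M → x ∈ P n → ∃ z ∈ M, f n x = t • z := fun n x hx hxn => by
    refine ⟨(1 / t) • x + (1 - 1 / t) • c (u n) x, hMc hx hxn.1 (by positivity) ?_ (by ring), ?_⟩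
    · rw [sub_nonneg, div_le_one ht0]; exact ht
    · ext j
      by_cases h : (j : ℕ) < i
      · simp [f, T, hg, w, c, h]; field_simp; ring
      · simp [f, T, hg, w, c, h]; left; ring
  have hkey : ∀ m n, ∀ x ∈ B ∩ P m, ∀ y ∈ B ∩ P n, f m x - f n y ∈ L → m = n ∧ x = y := by
    intro m n x hx y hy h
    obtain ⟨z, hz, hfz⟩ := hfM m x (hBM hx.1) hx.2
    obtain ⟨z', hz', hfz'⟩ := hfM n y (hBM hy.1) hy.2
    have h1 := hL z hz z' hz' (by rw [← hfz, ← hfz']; exact h)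
    have h2 : ∀ j : Fin d, i ≤ j → x j = y j := fun j hj => by
      have e1 := congrFun hfz j
      have e2 := congrFun hfz' j
      simp [f, T, hg, w, not_lt.mpr hj, ht0.ne'] at e1 e2
      rw [e1, e2, h1 j hj]
    have hmn := hPuniq hx.2 hy.2 h2
    refine ⟨hmn, hpack x hx.1 y hy.1 ?_⟩
    subst hmn
    have : f m x - f m y = x - y := by
      ext j
      by_cases hj : (j : ℕ) < i
      · simp [f, hg, w, hj]
      · simp [f, hg, w, hj, h2 j (not_lt.mp hj)]
    rwa [← this]
  have hdg : LinearMap.det g ≠ 0 := by rw [hdet]; positivity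
  have hfm : ∀ n, MeasurableSet (f n '' (B ∩ P n)) := fun n => by
    have : f n '' (B ∩ P n) = (fun x => T n + x) '' (g '' (B ∩ P n)) := by
      rw [Set.image_image]
    rw [this]
    have h1 : MeasurableSet (g '' (B ∩ P n)) := by
      have := ((LinearMap.equivOfDetNeZero g hdg).toContinuousLinearEquiv.toHomeomorph
        |>.toMeasurableEquiv).measurableSet_image.mpr (hB.inter (hP n))
      exact this
    rw [Set.image_add_left]
    exact measurable_const_add _ h1
  refine ⟨⋃ n, f n '' (B ∩ P n), ?_, MeasurableSet.iUnion hfm, ?_, ?_⟩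
  · intro z hz
    obtain ⟨n, x, hx, rfl⟩ := Set.mem_iUnion.mp hz
    exact hfM n x (hBM hx.1) hx.2
  · intro a ha b hb hab
    obtain ⟨n, x, hx, rfl⟩ := Set.mem_iUnion.mp ha
    obtain ⟨m, y, hy, rfl⟩ := Set.mem_iUnion.mp hb
    obtain ⟨rfl, rfl⟩ := hkey n m x hx y hy hab
    rfl
  · rw [measure_iUnion _ hfm]
    · have h1 : ∀ n, volume (f n '' (B ∩ P n)) = ENNReal.ofReal (t ^ (d - i)) *
          volume (B ∩ P n) := fun n => by
        have : f n '' (B ∩ P n) = (fun x => T n + x) '' (g '' (B ∩ P n)) := by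
          rw [Set.image_image]
        rw [this, Set.image_add_left, measure_preimage_add, Measure.addHaar_image_linearMap, hdet,
          abs_of_pos (by positivity)]
      simp_rw [h1]
      rw [ENNReal.tsum_mul_left, ← measure_iUnion _ fun n => hB.inter (hP n)]
      · congr 2
        rw [← Set.inter_iUnion]
        exact Set.inter_eq_left.mpr fun x hx => Set.mem_iUnion.mpr (hex x (hBM hx))
      · intro m n hmn
        refine Set.disjoint_left.mpr fun x hx hy => hmn (hPuniq hx.2 hy.2 fun _ _ => rfl)
    · intro m n hmn
      refine Set.disjoint_left.mpr ?_
      rintro _ ⟨x, hx, rfl⟩ ⟨y, hy, hxy⟩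
      refine hmn (hkey m n x hx y hy ?_).1
      rw [hxy, sub_self]
      exact L.zero_mem

open MeasureTheory in
/-- The inductive construction in Minkowski's second theorem: `l i • K` contains a set with pairwise
incongruent points of volume `l 0 ⋯ l (i - 1) · l i ^ (d - i) · vol K`. -/
theorem exists_packing_of_flag {d : ℕ} {K : Set (Fin d → ℝ)} (hKo : IsOpen K)
    (hKc : Convex ℝ K) (l : ℕ → ℝ) (hl0 : 0 < l 0) (hl : ∀ i, i + 1 < d → l i ≤ l (i + 1))
    (L : AddSubgroup (Fin d → ℝ))
    (hL : ∀ i < d, ∀ x ∈ K, ∀ y ∈ K, l i • x - l i • y ∈ L → ∀ j : Fin d, i ≤ j → x j = y j)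
    (i : ℕ) (hi : i < d) :
    0 < l i ∧ ∃ B : Set (Fin d → ℝ), (∀ z ∈ B, ∃ x ∈ K, z = l i • x) ∧ MeasurableSet B ∧
      (∀ x ∈ B, ∀ y ∈ B, x - y ∈ L → x = y) ∧
      volume B = ENNReal.ofReal ((∏ j ∈ Finset.range i, l j) * l i ^ (d - i)) * volume K := by
  induction i with
  | zero =>
    refine ⟨hl0, (fun x => l 0 • x) '' K, ?_, ?_, ?_, ?_⟩
    · rintro _ ⟨x, hx, rfl⟩; exact ⟨x, hx, rfl⟩
    · exact (hKo.smul₀ hl0.ne').measurableSet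
    · rintro _ ⟨x, hx, rfl⟩ _ ⟨y, hy, rfl⟩ h
      have : x = y := funext fun j => hL 0 hi x hx y hy h j (Nat.zero_le _)
      rw [this]
    · have := Measure.addHaar_smul_of_nonneg (volume : Measure (Fin d → ℝ)) hl0.le K
      rw [finrank_fin_fun] at this
      simpa only [Finset.range_zero, Finset.prod_empty, one_mul, Nat.sub_zero] using! this
  | succ i ih =>
    obtain ⟨hpos, B, hBK, hBm, hBp, hBv⟩ := ih (by omega)
    have hle := hl i hi
    have hpos' : 0 < l (i + 1) := hpos.trans_le hle
    have hmul : l (i + 1) / l i * l i = l (i + 1) := div_mul_cancel₀ _ hpos.ne'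
    obtain ⟨B', h1, h2, h3, h4⟩ := exists_packing_expand (M := l i • K) (B := B)
      (hKo.smul₀ hpos.ne') (hKc.smul _) (fun z hz => by
        obtain ⟨x, hx, rfl⟩ := hBK z hz
        exact Set.smul_mem_smul_set hx) hBm (t := l (i + 1) / l i)
      ((one_le_div hpos).mpr hle) (i + 1) L hBp (by
        rintro _ ⟨x, hx, rfl⟩ _ ⟨y, hy, rfl⟩ h j hj
        simp only [smul_smul, hmul] at h
        simp [hL (i + 1) hi x hx y hy h j hj])
    refine ⟨hpos', B', ?_, h2, h3, ?_⟩
    · intro z hz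
      obtain ⟨_, ⟨x, hx, rfl⟩, rfl⟩ := h1 z hz
      exact ⟨x, hx, by simp only [smul_smul, hmul]⟩
    · rw [h4, hBv, ← mul_assoc, ← ENNReal.ofReal_mul (by positivity)]
      congr 2
      obtain ⟨e, he⟩ : ∃ e, d = i + 1 + e := ⟨d - (i + 1), by omega⟩
      have e1 : d - (i + 1) = e := by omega
      have e2 : d - i = e + 1 := by omega
      rw [e1, e2, Finset.prod_range_succ, div_pow]
      field_simp
      ring

open MeasureTheory in
/-- **Minkowski's second theorem**, in coordinates with respect to a basis realising the successive
minima `l i`. The set `K` is half of the convex body, and the hypothesis `hL` says that lattice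
points in the interior of `l i` times the body lie in the span of the first `i` coordinate
vectors. -/
theorem prod_mul_volume_le_volume_fundamentalDomain {d : ℕ} (hd : 0 < d) {K : Set (Fin d → ℝ)}
    (hKo : IsOpen K) (hKc : Convex ℝ K) (l : ℕ → ℝ) (hl0 : 0 < l 0)
    (hl : ∀ i, i + 1 < d → l i ≤ l (i + 1)) (b : Basis (Fin d) ℝ (Fin d → ℝ))
    (hL : ∀ i < d, ∀ x ∈ K, ∀ y ∈ K, l i • x - l i • y ∈ Submodule.span ℤ (Set.range b) →
      ∀ j : Fin d, i ≤ j → x j = y j) :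
    ENNReal.ofReal (∏ j ∈ Finset.range d, l j) * volume K ≤
      volume (ZSpan.fundamentalDomain b) := by
  obtain ⟨-, B, -, hBm, hBp, hBv⟩ := exists_packing_of_flag hKo hKc l hl0 hl
    (Submodule.span ℤ (Set.range b)).toAddSubgroup hL (d - 1) (by omega)
  obtain ⟨e, rfl⟩ : ∃ e, d = e + 1 := ⟨d - 1, by omega⟩
  have e1 : (∏ j ∈ Finset.range e, l j) * l e ^ (e + 1 - e) = ∏ j ∈ Finset.range (e + 1), l j := by
    rw [Finset.prod_range_succ]; simp
  rw [Nat.add_sub_cancel, e1] at hBv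
  rw [← hBv]
  by_contra! hlt
  have : Countable (Submodule.span ℤ (Set.range b)).toAddSubgroup :=
    inferInstanceAs (Countable (Submodule.span ℤ (Set.range b)))
  obtain ⟨x, y, hxy, h⟩ := exists_pair_mem_lattice_not_disjoint_vadd
    (ZSpan.isAddFundamentalDomain' b volume) hBm.nullMeasurableSet hlt
  refine h (Set.disjoint_left.mpr ?_)
  rintro _ ⟨p, hp, rfl⟩ ⟨q, hq, hpq⟩
  have hpq' : (y : Fin (e + 1) → ℝ) + q = x + p := hpq
  have h1 : p - q = y - x := by
    rw [sub_eq_sub_iff_add_eq_add, add_comm p, ← hpq']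
  have h2 : p = q := hBp p hp q hq (by
    rw [h1]; exact Submodule.sub_mem _ y.2 x.2)
  apply hxy
  rw [h2, sub_self] at h1
  exact Subtype.ext (sub_eq_zero.mp h1.symm).symm

/-! ### The cross-polytope estimate -/

open MeasureTheory in
theorem volume_sum_abs_lt_one {d : ℕ} :
    volume {x : Fin d → ℝ | ∑ i, |x i| < 1} = ENNReal.ofReal (2 ^ d / (d.factorial : ℝ)) := by
  have h := volume_sum_rpow_lt_one (Fin d) (le_refl (1 : ℝ))
  have h2 : Real.Gamma (1 + 1) = 1 := by simpa using Real.Gamma_nat_eq_factorial 1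
  simpa [Real.Gamma_nat_eq_factorial, h2] using h

open MeasureTheory in
/-- If the standard basis realises the successive minima `l j` of the unit ball of `p` with respect
to the lattice spanned by `b`, then the `j`-th coordinate on that ball is at most
`d! · covolume / l j`: compare the volume of the ball, as bounded by Minkowski's second theorem,
with that of the cross-polytope on `x` and the vectors `e_i / l i`, `i ≠ j`. -/
theorem abs_apply_mul_le_factorial_mul_det {d : ℕ} (hd : 0 < d) (p : Seminorm ℝ (Fin d → ℝ))
    (hp : Continuous p) (l : ℕ → ℝ) (hl0 : 0 < l 0) (hl : ∀ i, i + 1 < d → l i ≤ l (i + 1))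
    (he : ∀ j : Fin d, p (Pi.single j 1) ≤ l j) (b : Basis (Fin d) ℝ (Fin d → ℝ))
    (hL : ∀ i < d, ∀ z ∈ Submodule.span ℤ (Set.range b), p z < l i → ∀ j : Fin d, i ≤ j → z j = 0)
    {x : Fin d → ℝ} (hx : p x ≤ 1) (j : Fin d) :
    |x j| * l j ≤ d.factorial * |(Matrix.of b).det| := by
  have hpos : ∀ i, i < d → 0 < l i := fun i => by
    induction i with
    | zero => exact fun _ => hl0
    | succ i ih => exact fun h => (ih (by omega)).trans_le (hl i h)
  set K : Set (Fin d → ℝ) := p.ball 0 2⁻¹ with hK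
  have hKo : IsOpen K := by
    have : K = {x | p x < 2⁻¹} := by ext; simp [hK, Seminorm.mem_ball]
    rw [this]
    exact isOpen_lt hp continuous_const
  have hM := prod_mul_volume_le_volume_fundamentalDomain hd hKo (p.convex_ball 0 2⁻¹) l hl0 hl b
    (fun i hi y hy z hz h k hk => by
      rw [Seminorm.mem_ball_zero] at hy hz
      have h1 : p (l i • y - l i • z) < l i := by
        rw [← smul_sub, map_smul_eq_mul, Real.norm_of_nonneg (hpos i hi).le]
        have : p (y - z) < 1 := by linarith [map_sub_le_add p y z]
        nlinarith [hpos i hi]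
      have h2 := hL i hi _ h h1 k hk
      simp only [Pi.sub_apply, Pi.smul_apply, smul_eq_mul, ← mul_sub, mul_eq_zero,
        (hpos i hi).ne', false_or] at h2
      linarith)
  rw [ZSpan.volume_fundamentalDomain] at hM
  -- The columns of `A` are the vertices of the cross-polytope.
  let A : Matrix (Fin d) (Fin d) ℝ := (Matrix.diagonal fun i : Fin d => (l i)⁻¹).updateCol j x
  have hA : A.det = (∏ i ∈ Finset.univ.erase j, (l (i : Fin d))⁻¹) * x j := by
    rw [← Matrix.cramer_apply, Matrix.cramer_eq_adjugate_mulVec, Matrix.adjugate_diagonal,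
      Matrix.mulVec_diagonal]
  have hcol : ∀ i, p (A.col i) ≤ 1 := fun i => by
    by_cases hij : i = j
    · have : A.col i = x := by ext k; simp [A, hij, Matrix.col]
      rwa [this]
    · have : A.col i = (l i)⁻¹ • Pi.single i 1 := by
        ext k; simp [A, hij, Matrix.col, Matrix.diagonal_apply, Pi.single_apply]
        split_ifs with h
        · rw [h]
        · rfl
      rw [this, map_smul_eq_mul, Real.norm_of_nonneg (inv_nonneg.mpr (hpos i i.2).le)]
      exact inv_mul_le_one_of_le₀ (he i) (hpos i i.2).le
  have hsub : Matrix.toLin' A '' {x : Fin d → ℝ | ∑ i, |x i| < 1} ⊆ (2 : ℝ) • K := by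
    rintro _ ⟨t, ht, rfl⟩
    rw [hK, Seminorm.smul_ball_zero two_ne_zero, Seminorm.mem_ball_zero]
    have h1 : Matrix.toLin' A t = ∑ i, t i • A.col i := by
      ext k
      simp [Matrix.mulVec, dotProduct, Matrix.col, mul_comm]
    rw [h1]
    calc p (∑ i, t i • A.col i) ≤ ∑ i, p (t i • A.col i) := 
          Finset.le_sum_of_subadditive p (map_zero p).le (map_add_le_add p) _ _
      _ ≤ ∑ i, |t i| := Finset.sum_le_sum fun i _ => by
          rw [map_smul_eq_mul, Real.norm_eq_abs]
          exact mul_le_of_le_one_right (abs_nonneg _) (hcol i)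
      _ < ‖(2 : ℝ)‖ * 2⁻¹ := by simpa using ht
  have hvol := measure_mono (μ := volume) hsub
  rw [Measure.addHaar_image_linearMap, LinearMap.det_toLin', volume_sum_abs_lt_one, hA,
    Measure.addHaar_smul_of_nonneg _ zero_le_two, finrank_fin_fun] at hvol
  have hprod : 0 < ∏ i ∈ Finset.range d, l i :=
    Finset.prod_pos fun i hi => hpos i (Finset.mem_range.mp hi)
  have hfin : volume K ≠ ⊤ := fun h => by
    rw [h, ENNReal.mul_top (by simpa using hprod)] at hM
    exact absurd hM (by simp)
  obtain ⟨v, hv⟩ : ∃ v : NNReal, volume K = ENNReal.ofReal v :=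
    ⟨(volume K).toNNReal, by simp [hfin]⟩
  rw [hv, ← ENNReal.ofReal_mul hprod.le, ENNReal.ofReal_le_ofReal_iff (abs_nonneg _)] at hM
  rw [hv, ← ENNReal.ofReal_mul (abs_nonneg _), ← ENNReal.ofReal_mul (by positivity),
    ENNReal.ofReal_le_ofReal_iff (by positivity), abs_mul] at hvol
  rw [← Fin.prod_univ_eq_prod_range, ← Finset.mul_prod_erase _ _ (Finset.mem_univ j)] at hM
  have hQ : 0 < ∏ i ∈ Finset.univ.erase j, l (i : Fin d) :=
    Finset.prod_pos fun i _ => hpos i i.2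
  rw [Finset.prod_inv_distrib, abs_inv, abs_of_pos hQ] at hvol
  set P := ∏ i ∈ Finset.univ.erase j, l (i : Fin d)
  have h3 : |x j| ≤ d.factorial * (P * v) := by
    have hf : (0 : ℝ) < d.factorial := by positivity
    have h2 : (0 : ℝ) < 2 ^ d := by positivity
    have : P⁻¹ * |x j| * (2 ^ d / d.factorial) = 2 ^ d * (|x j| / (P * d.factorial)) := by
      field_simp
    rw [this] at hvol
    have := le_of_mul_le_mul_left hvol h2
    rw [div_le_iff₀ (by positivity)] at this
    linarith
  calc |x j| * l j ≤ (d.factorial * (P * v)) * l j :=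
        mul_le_mul_of_nonneg_right h3 (hpos j j.2).le
    _ = d.factorial * (l j * P * v) := by ring
    _ ≤ _ := by gcongr

/-! ### Successive minima and the transference theorem -/

theorem linearIndependent_of_notMem_span_range {V : Type*} [AddCommGroup V] [Module ℝ V]
    (a : ℕ → V) (m : ℕ)
    (h : ∀ i < m, a i ∉ Submodule.span ℝ (Set.range fun j : Fin i => a j)) :
    LinearIndependent ℝ (fun i : Fin m => a i) := by
  induction m with
  | zero => exact linearIndependent_empty_type
  | succ m ih =>
    exact linearIndependent_finSucc'.mpr ⟨ih fun i hi => h i (by omega), h m (by omega)⟩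

/-- Lattice points realising the successive minima, chosen greedily: `a i` minimises `p` on the
points of `L` outside the span of `a 0, …, a (i - 1)`. Only the values `a i` with `i < m` matter. -/
theorem exists_successive_minima {V : Type*} [AddCommGroup V] [Module ℝ V] [FiniteDimensional ℝ V]
    (L : Set V) (hspan : Submodule.span ℝ L = ⊤) (p : V → ℝ)
    (hfin : ∀ r, {x | x ∈ L ∧ p x ≤ r}.Finite) (m : ℕ) (hm : m ≤ finrank ℝ V) :
    ∃ a : ℕ → V, ∀ i < m, a i ∈ L ∧ a i ∉ Submodule.span ℝ (Set.range fun j : Fin i => a j) ∧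
      ∀ x ∈ L, x ∉ Submodule.span ℝ (Set.range fun j : Fin i => a j) → p (a i) ≤ p x := by
  classical
  induction m with
  | zero => exact ⟨0, by simp⟩
  | succ m ih =>
    obtain ⟨a, ha⟩ := ih (by omega)
    set W := Submodule.span ℝ (Set.range fun j : Fin m => a j) with hW
    have hWtop : W ≠ ⊤ := fun h => by
      have h1 : finrank ℝ W ≤ m := by
        simpa using! finrank_range_le_card (R := ℝ) fun j : Fin m => a j
      rw [h, finrank_top] at h1
      omega
    obtain ⟨x₀, hx₀, hx₀W⟩ : ∃ x ∈ L, x ∉ W := by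
      by_contra! h
      exact hWtop (top_le_iff.mp (hspan ▸ Submodule.span_le.mpr h))
    obtain ⟨v, hv, hmin⟩ := Set.exists_min_image {x | (x ∈ L ∧ p x ≤ p x₀) ∧ x ∉ W} p
      ((hfin (p x₀)).subset fun x hx => hx.1) ⟨x₀, ⟨hx₀, le_rfl⟩, hx₀W⟩
    have hup : ∀ i ≤ m, (fun j : Fin i => Function.update a m v j) = fun j : Fin i => a j :=
      fun i hi => funext fun j => Function.update_of_ne (by omega) _ _
    refine ⟨Function.update a m v, fun i hi => ?_⟩
    rw [hup i (by omega)]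
    rcases Nat.lt_succ_iff_lt_or_eq.mp hi with h | rfl
    · rw [Function.update_of_ne h.ne]
      exact ha i h
    · rw [Function.update_self]
      refine ⟨hv.1.1, hv.2, fun x hx hxW => ?_⟩
      by_cases h : p x ≤ p x₀
      · exact hmin x ⟨⟨hx, h⟩, hxW⟩
      · exact hv.1.2.trans (not_le.mp h).le

/-- Cramer's rule: if the basis `A` lies in the lattice spanned by `G`, the coordinates of lattice
points with respect to `A` have denominators dividing `G.det A`. -/
theorem det_mul_coord_mem_range_intCast {V : Type*} [AddCommGroup V] [Module ℝ V] {ι : Type*}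
    [Fintype ι] [DecidableEq ι] (G A : Basis ι ℝ V)
    (hA : ∀ i, A i ∈ Submodule.span ℤ (Set.range G)) {x : V}
    (hx : x ∈ Submodule.span ℤ (Set.range G)) (j : ι) :
    ∃ m : ℤ, G.det A * A.coord j x = m := by
  choose M hM using fun i => (G.mem_span_iff_repr_mem ℤ (A i)).mp (hA i)
  choose c hc using (G.mem_span_iff_repr_mem ℤ x).mp hx
  set N : Matrix ι ι ℤ := Matrix.of fun i j => M j i with hN
  have hNG : (Int.castRingHom ℝ).mapMatrix N = G.toMatrix A := by
    ext i j
    simpa [hN, Basis.toMatrix_apply] using hM j i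
  have h1 : G.det A • (A.repr x : ι → ℝ) = (G.toMatrix A).adjugate.mulVec (G.repr x) := by
    rw [← Basis.toMatrix_mulVec_repr A G x, Matrix.mulVec_mulVec, Matrix.adjugate_mul,
      Matrix.smul_mulVec, Matrix.one_mulVec, Basis.det_apply]
  refine ⟨N.adjugate.mulVec c j, ?_⟩
  have h2 := congrFun h1 j
  rw [← hNG, ← RingHom.map_adjugate] at h2
  simp only [Pi.smul_apply, smul_eq_mul] at h2
  rw [Basis.coord_apply, h2]
  simp only [Matrix.mulVec, dotProduct, RingHom.mapMatrix_apply, Matrix.map_apply, Int.cast_sum,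
    Int.cast_mul, ← hc]
  rfl

/-- **Mahler's transference theorem** with the constant `d!`: if the `k`-th successive minimum of the
unit ball of `p` is at least `1`, there are `d + 1 - k` independent functionals that are integral on
the lattice and bounded by `d!` on that ball. -/
theorem exists_dual_lattice_vectors {V : Type*} [AddCommGroup V] [Module ℝ V]
    [FiniteDimensional ℝ V] {d : ℕ} (G : Basis (Fin d) ℝ V) (p : Seminorm ℝ V)
    (hp0 : ∀ x, p x = 0 → x = 0)
    (hfin : ∀ r, {x | x ∈ Submodule.span ℤ (Set.range G) ∧ p x ≤ r}.Finite)
    (k : ℕ) (hk1 : 1 ≤ k) (hkd : k ≤ d)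
    (hk : ¬ ∃ x : Fin k → V, LinearIndependent ℝ x ∧
      ∀ i, x i ∈ Submodule.span ℤ (Set.range G) ∧ p (x i) < 1) :
    ∃ φ : Fin (d + 1 - k) → (V →ₗ[ℝ] ℝ), LinearIndependent ℝ φ ∧
      ∀ i, (∀ x ∈ Submodule.span ℤ (Set.range G), ∃ m : ℤ, φ i x = m) ∧
        ∀ x, |φ i x| ≤ d.factorial * p x := by
  classical
  have hd : finrank ℝ V = d := by simpa using finrank_eq_card_basis G
  have hspan : Submodule.span ℝ (Submodule.span ℤ (Set.range G) : Set V) = ⊤ := by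
    rw [eq_top_iff, ← G.span_eq]
    exact Submodule.span_mono Submodule.subset_span
  obtain ⟨a, ha⟩ := exists_successive_minima (Submodule.span ℤ (Set.range G) : Set V) hspan p hfin
    d hd.ge
  have hLI := linearIndependent_of_notMem_span_range a d fun i hi => (ha i hi).2.1
  have hne : Nonempty (Fin d) := ⟨⟨0, by omega⟩⟩
  let A : Basis (Fin d) ℝ V := basisOfLinearIndependentOfCardEqFinrank hLI (by simp [hd])
  have hAa : ∀ i : Fin d, A i = a i := fun i => by simp [A]
  have hmono : ∀ i j, i ≤ j → j < d → p (a i) ≤ p (a j) := fun i j hij hj =>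
    (ha i (by omega)).2.2 _ (ha j hj).1 fun h => (ha j hj).2.1 (by
      refine Submodule.span_mono ?_ h
      rintro _ ⟨r, rfl⟩
      exact ⟨⟨r, by omega⟩, rfl⟩)
  have hpos : 0 < p (a 0) := (apply_nonneg p _).lt_of_ne' fun h =>
    (ha 0 (by omega)).2.1 (by rw [hp0 _ h]; exact Submodule.zero_mem _)
  have hge : 1 ≤ p (a (k - 1)) := by
    by_contra! h
    refine hk ⟨fun i => a i, linearIndependent_of_notMem_span_range a k
      fun i hi => (ha i (by omega)).2.1, fun i => ⟨(ha i (by omega)).1, ?_⟩⟩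
    exact (hmono i (k - 1) (by omega) (by omega)).trans_lt h
  let q : Seminorm ℝ (Fin d → ℝ) := p.comp A.equivFun.symm.toLinearMap
  have hq : ∀ y, q y = p (A.equivFun.symm y) := fun y => rfl
  have hqc : Continuous q :=
    continuousOn_univ.mp (ConvexOn.continuousOn isOpen_univ q.convexOn)
  let b : Basis (Fin d) ℝ (Fin d → ℝ) := G.map A.equivFun
  have hb : ∀ z ∈ Submodule.span ℤ (Set.range b),
      A.equivFun.symm z ∈ Submodule.span ℤ (Set.range G) := fun z hz => by
    have : Submodule.span ℤ (Set.range b) ≤ (Submodule.span ℤ (Set.range G)).comap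
        (A.equivFun.symm.toLinearMap.restrictScalars ℤ) := by
      rw [Submodule.span_le]
      rintro _ ⟨i, rfl⟩
      have : A.equivFun.symm (b i) = G i := by simp [b]
      simp only [Submodule.comap_coe, Set.mem_preimage, LinearMap.coe_restrictScalars,
        LinearEquiv.coe_coe, this]
      exact Submodule.subset_span ⟨i, rfl⟩
    exact this hz
  have hdetb : (Matrix.of b).det = A.det G := by
    rw [Basis.det_apply, ← Matrix.det_transpose]
    congr 1
  have hbound : ∀ (j : Fin d) (x : V), p x ≤ 1 →
      |A.coord j x| * p (a j) ≤ d.factorial * |A.det G| := fun j x hx => by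
    rw [← hdetb]
    have := abs_apply_mul_le_factorial_mul_det (by omega : 0 < d) q hqc (fun i => p (a i)) hpos
      (fun i hi => hmono i (i + 1) (by omega) hi)
      (fun j => by
        have : A.equivFun.symm (Pi.single j 1) = a j := by
          rw [Basis.equivFun_symm_apply]
          simp [Pi.single_apply, hAa]
        rw [hq, this]) b
      (fun i hi z hz hzi j hij => by
        have h1 : A.equivFun.symm z ∈ Submodule.span ℝ (Set.range fun j : Fin i => a j) := by
          by_contra h
          exact (((ha i hi).2.2 _ (hb z hz) h).trans_lt hzi).false
        have h2 : Submodule.span ℝ (Set.range fun j : Fin i => a j) ≤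
            LinearMap.ker (A.coord j) := by
          rw [Submodule.span_le]
          rintro _ ⟨r, rfl⟩
          have h3 : a r = A ⟨r, by omega⟩ := (hAa ⟨r, by omega⟩).symm
          simp only [SetLike.mem_coe, LinearMap.mem_ker, h3, Basis.coord_apply, Basis.repr_self]
          exact Finsupp.single_eq_of_ne (by rw [Ne, Fin.ext_iff]; simp; omega)
        have h3 := h2 h1
        rw [LinearMap.mem_ker, Basis.coord_apply, ← Basis.equivFun_apply,
          LinearEquiv.apply_symm_apply] at h3
        exact h3)
      (x := A.equivFun x) (by rw [hq, LinearEquiv.symm_apply_apply]; exact hx) j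
    exact this
  have hdet : G.det A * A.det G = 1 := by rw [Basis.det_mul_det, Basis.det_self]
  have hdet0 : G.det A ≠ 0 := left_ne_zero_of_mul_eq_one hdet
  let e : Fin (d + 1 - k) → Fin d := fun i => ⟨k - 1 + i, by omega⟩
  have he : Function.Injective e := fun i j h => by
    simp only [e, Fin.mk.injEq] at h
    exact Fin.ext (by omega)
  -- The minima with (zero-based) index at least `k - 1` are at least `1`; their coordinate
  -- functionals are the ones to take.
  refine ⟨fun i => G.det A • A.coord (e i), ?_, fun i => ⟨fun x hx => ?_, fun x => ?_⟩⟩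
  · have h1 : LinearIndependent ℝ A.coord := by
      rw [← Basis.coe_dualBasis]
      exact A.dualBasis.linearIndependent
    exact (h1.comp e he).units_smul fun _ => Units.mk0 _ hdet0
  · obtain ⟨m, hm⟩ := det_mul_coord_mem_range_intCast G A
      (fun i => by rw [hAa]; exact (ha i i.2).1) hx (e i)
    exact ⟨m, hm⟩
  · have hx1 : |A.coord (e i) x| ≤ d.factorial * |A.det G| * p x := by
      by_cases hx : p x = 0
      · rw [hp0 x hx]; simp
      have hx' : 0 < p x := (apply_nonneg p _).lt_of_ne' hx
      have h1 := hbound (e i) ((p x)⁻¹ • x) (by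
        rw [map_smul_eq_mul, Real.norm_of_nonneg (by positivity), inv_mul_cancel₀ hx])
      have h2 : 1 ≤ p (a (e i)) := hge.trans (hmono _ _ (by simp [e]) (e i).2)
      rw [map_smul, smul_eq_mul, abs_mul, abs_inv, abs_of_pos hx'] at h1
      have h3 := (le_mul_of_one_le_right (by positivity) h2).trans h1
      rwa [inv_mul_le_iff₀ hx', mul_comm] at h3
    rw [LinearMap.smul_apply, smul_eq_mul, abs_mul]
    calc |G.det A| * |A.coord (e i) x| ≤ |G.det A| * (d.factorial * |A.det G| * p x) := by gcongr
      _ = d.factorial * |G.det A * A.det G| * p x := by rw [abs_mul]; ring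
      _ = _ := by rw [hdet, abs_one, mul_one]

/-! ### The sup norm and the lattice -/

theorem abs_apply_le_supNorm {n : ℕ} (x : EuclideanSpace ℝ (Fin n)) (j : Fin n) :
    |x j| ≤ supNorm x := norm_le_pi_norm (WithLp.ofLp x) j

theorem supNorm_nonneg {n : ℕ} (x : EuclideanSpace ℝ (Fin n)) : 0 ≤ supNorm x := norm_nonneg _

theorem supNorm_le_iff {n : ℕ} {x : EuclideanSpace ℝ (Fin n)} {r : ℝ} (hr : 0 ≤ r) :
    supNorm x ≤ r ↔ ∀ j, |x j| ≤ r := pi_norm_le_iff_of_nonneg hr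

theorem supNorm_eq_zero {n : ℕ} {x : EuclideanSpace ℝ (Fin n)} : supNorm x = 0 ↔ x = 0 := by
  rw [supNorm, norm_eq_zero]
  exact WithLp.ofLp_eq_zero 2

theorem supNorm_smul {n : ℕ} (c : ℝ) (x : EuclideanSpace ℝ (Fin n)) :
    supNorm (c • x) = |c| * supNorm x := norm_smul c (WithLp.ofLp x)

theorem supNorm_sub_le {n : ℕ} (x y : EuclideanSpace ℝ (Fin n)) :
    supNorm (x - y) ≤ supNorm x + supNorm y := norm_sub_le (WithLp.ofLp x) (WithLp.ofLp y)

theorem supNorm_le_norm {n : ℕ} (x : EuclideanSpace ℝ (Fin n)) : supNorm x ≤ ‖x‖ :=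
  (supNorm_le_iff (norm_nonneg x)).mpr fun j => PiLp.norm_apply_le x j

theorem inner_eq_sum_mul {n : ℕ} (x y : EuclideanSpace ℝ (Fin n)) :
    inner ℝ x y = ∑ j, x j * y j := by
  simp [PiLp.inner_apply, mul_comm]

theorem abs_inner_le_supNorm {n : ℕ} (x y : EuclideanSpace ℝ (Fin n)) :
    |inner ℝ x y| ≤ n * (supNorm x * supNorm y) := by
  rw [inner_eq_sum_mul]
  calc |∑ j, x j * y j| ≤ ∑ j, |x j * y j| := Finset.abs_sum_le_sum_abs _ _
    _ ≤ ∑ _j : Fin n, supNorm x * supNorm y := Finset.sum_le_sum fun j _ => by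
        rw [abs_mul]
        exact mul_le_mul (abs_apply_le_supNorm x j) (abs_apply_le_supNorm y j) (abs_nonneg _)
          (supNorm_nonneg _)
    _ = _ := by simp

variable {n : ℕ} (α : EuclideanSpace ℝ (Fin n))

/-- A `ℤ`-basis of `Λ`, as an `ℝ`-basis of the rational hull. -/
def hullBasis : Basis (Fin (effFreq α)) ℝ (rationalHull α) :=
  haveI := ZLattice.module_finite ℝ (hullLattice α)
  haveI := ZLattice.module_free ℝ (hullLattice α)
  (Module.finBasisOfFinrankEq ℤ (hullLattice α)
    (ZLattice.rank ℝ (hullLattice α))).ofZLatticeBasis ℝ (hullLattice α)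

theorem span_range_hullBasis : Submodule.span ℤ (Set.range (hullBasis α)) = hullLattice α :=
  Basis.ofZLatticeBasis_span ℝ _ _

theorem hullBasis_mem (i : Fin (effFreq α)) : hullBasis α i ∈ hullLattice α := by
  rw [← span_range_hullBasis]
  exact Submodule.subset_span ⟨i, rfl⟩

theorem latticeDet_hullLattice :
    latticeDet (hullLattice α) =
      |(stdOrthonormalBasis ℝ (rationalHull α)).toBasis.det (hullBasis α)| := by
  rw [latticeDet]
  congr 2
  ext1 i
  exact (Basis.ofZLatticeBasis_apply ℝ _ _ _).symm

theorem latticeDet_pos : 0 < latticeDet (hullLattice α) := by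
  rw [latticeDet_hullLattice]
  exact abs_pos.mpr (Basis.isUnit_det _ (hullBasis α)).ne_zero

theorem exists_int_inner_eq {x y : rationalHull α} (hx : x ∈ hullLattice α)
    (hy : y ∈ hullLattice α) :
    ∃ m : ℤ, inner ℝ (x : EuclideanSpace ℝ (Fin n)) (y : EuclideanSpace ℝ (Fin n)) = m := by
  choose a ha using hx
  choose b hb using hy
  exact ⟨∑ j, a j * b j, by simp [inner_eq_sum_mul, ha, hb]⟩

theorem one_le_supNorm {x : rationalHull α} (hx : x ∈ hullLattice α) (hx0 : x ≠ 0) :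
    1 ≤ supNorm (x : EuclideanSpace ℝ (Fin n)) := by
  have : ∃ j, (x : EuclideanSpace ℝ (Fin n)) j ≠ 0 := by
    by_contra! h
    exact hx0 (Subtype.ext (by ext j; exact h j))
  obtain ⟨j, hj⟩ := this
  obtain ⟨m, hm⟩ := hx j
  refine le_trans ?_ (abs_apply_le_supNorm _ j)
  rw [hm] at hj ⊢
  have : m ≠ 0 := fun h => hj (by simp [h])
  change (1 : ℝ) ≤ |(m : ℝ)|
  exact_mod_cast Int.one_le_abs this

theorem finite_hullLattice_supNorm_le (r : ℝ) :
    {x : rationalHull α | x ∈ hullLattice α ∧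
      supNorm (x : EuclideanSpace ℝ (Fin n)) ≤ r}.Finite := by
  let e := (PiLp.continuousLinearEquiv 2 ℝ (fun _ : Fin n => ℝ)).symm.toContinuousLinearMap
  have hb : Bornology.IsBounded
      {x : rationalHull α | supNorm (x : EuclideanSpace ℝ (Fin n)) ≤ r} := by
    refine isBounded_iff_forall_norm_le.mpr ⟨‖e‖ * r, fun x hx => ?_⟩
    have h1 : e (WithLp.ofLp (x : EuclideanSpace ℝ (Fin n))) = x := rfl
    rw [Submodule.coe_norm, ← h1]
    exact (e.le_opNorm _).trans (mul_le_mul_of_nonneg_left hx (norm_nonneg _))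
  refine (ZSpan.setFinite_inter (hullBasis α) hb).subset fun x hx => ⟨hx.2, ?_⟩
  have := hx.1
  rw [← span_range_hullBasis] at this
  exact this

/-! ### Minimality of the rational hull -/

theorem isRational_of_coordMap_mem {W : Submodule ℝ (EuclideanSpace ℝ (Fin n))}
    (hW : ∀ (φ : ℝ →ₗ[ℚ] ℚ) (x : EuclideanSpace ℝ (Fin n)), x ∈ W → coordMap φ x ∈ W) :
    IsRational W := by
  set S : Set W := {y | ∀ j, ∃ q : ℚ, (y : EuclideanSpace ℝ (Fin n)) j = q} with hS
  have himg : {y : EuclideanSpace ℝ (Fin n) | y ∈ W ∧ ∀ j, ∃ q : ℚ, y j = q} =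
      W.subtype '' S := by
    ext y
    constructor
    · rintro ⟨h1, h2⟩
      exact ⟨⟨y, h1⟩, h2, rfl⟩
    · rintro ⟨z, hz, rfl⟩
      exact ⟨z.2, hz⟩
  have htop : Submodule.span ℝ S = ⊤ := by
    rw [eq_top_iff]
    rintro ⟨x, hx⟩ -
    have h := mem_span_rational hW hx
    rw [himg, Submodule.span_image] at h
    obtain ⟨z, hz, hzx⟩ := h
    have : z = ⟨x, hx⟩ := Subtype.ext hzx
    rwa [← this]
  obtain ⟨b, hb, hspan, hli⟩ := exists_linearIndependent ℝ S
  rw [htop] at hspan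
  let B : Basis b ℝ W := Basis.mk hli (by simp [hspan])
  have : Fintype b := FiniteDimensional.fintypeBasisIndex B
  refine ⟨_, B.reindex (Fintype.equivFin b), fun i j => ?_⟩
  have := hb ((Fintype.equivFin b).symm i).2 j
  simpa [B] using this

/-- By minimality of the rational hull, `α` is orthogonal to no nonzero point of `Λ`: the orthogonal
complement of an integer vector is rational. -/
theorem inner_ne_zero_of_mem_hullLattice {x : rationalHull α} (hx : x ∈ hullLattice α)
    (hx0 : x ≠ 0) : inner ℝ (x : EuclideanSpace ℝ (Fin n)) α ≠ 0 := by
  intro h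
  choose a ha using hx
  let W : Submodule ℝ (EuclideanSpace ℝ (Fin n)) :=
    (Submodule.span ℝ {(x : EuclideanSpace ℝ (Fin n))})ᗮ
  have hW : ∀ y, y ∈ W ↔ ∑ j, (a j : ℝ) * y j = 0 := fun y => by
    rw [Submodule.mem_orthogonal_singleton_iff_inner_right, inner_eq_sum_mul]
    simp [ha]
  have hrat : IsRational W := isRational_of_coordMap_mem fun φ y hy => by
    rw [hW] at hy ⊢
    have h1 := congrArg φ hy
    have h2 : ∀ (m : ℤ) (r : ℝ), φ (m * r) = m * φ r := fun m r => by
      have := map_zsmul φ m r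
      simpa using this
    rw [map_sum, map_zero] at h1
    simp only [h2] at h1
    simp only [coordMap]
    exact_mod_cast h1
  have hle := (isLeast_rationalHull α).2
    ⟨hrat, (Submodule.mem_orthogonal_singleton_iff_inner_right).mpr h⟩
  have h3 := (Submodule.mem_orthogonal_singleton_iff_inner_right).mp (hle x.2)
  exact hx0 (Subtype.ext (inner_self_eq_zero.mp h3))

/-! ### The dual lattice -/

/-- `(det Λ)²` times the dual lattice is contained in `Λ`: `(det Λ)²` is the determinant of the
integral Gram matrix of a basis, so this is Cramer's rule. -/
theorem latticeDet_sq_smul_mem {y : rationalHull α}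
    (hy : ∀ x ∈ hullLattice α, ∃ m : ℤ, inner ℝ y x = (m : ℝ)) :
    (latticeDet (hullLattice α) ^ 2) • y ∈ hullLattice α := by
  classical
  set G := hullBasis α
  choose N hN using fun i j => exists_int_inner_eq α (hullBasis_mem α i) (hullBasis_mem α j)
  choose m hm using fun i => hy _ (hullBasis_mem α i)
  let O : OrthonormalBasis (Fin (effFreq α)) ℝ (rationalHull α) :=
    stdOrthonormalBasis ℝ (rationalHull α)
  set M := O.toBasis.toMatrix G with hM
  have hgram : (Int.castRingHom ℝ).mapMatrix (Matrix.of N) = M.transpose * M := by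
    ext i j
    have h1 := O.sum_inner_mul_inner (G i) (G j)
    simp only [RingHom.mapMatrix_apply, Matrix.map_apply, Matrix.of_apply, Int.coe_castRingHom,
      Matrix.mul_apply, Matrix.transpose_apply, hM, Basis.toMatrix_apply]
    rw [← hN, ← Submodule.coe_inner, ← h1]
    refine Finset.sum_congr rfl fun r _ => ?_
    simp [OrthonormalBasis.repr_apply_apply, real_inner_comm]
  have hdet : ((Int.castRingHom ℝ).mapMatrix (Matrix.of N)).det =
      latticeDet (hullLattice α) ^ 2 := by
    rw [hgram, Matrix.det_mul, Matrix.det_transpose, latticeDet_hullLattice, sq_abs, sq]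
    rfl
  have hmul : ((Int.castRingHom ℝ).mapMatrix (Matrix.of N)).mulVec (G.repr y) =
      fun i => (m i : ℝ) := by
    ext i
    rw [← hm i]
    conv_rhs => rw [← G.sum_repr y, sum_inner]
    simp only [Matrix.mulVec, dotProduct, RingHom.mapMatrix_apply, Matrix.map_apply,
      Matrix.of_apply, Int.coe_castRingHom, ← hN, inner_smul_left]
    refine Finset.sum_congr rfl fun r _ => ?_
    rw [mul_comm, real_inner_comm]
    rfl
  suffices h : ∀ i, (hullBasis α).repr (latticeDet (hullLattice α) ^ 2 • y) i ∈
      Set.range (algebraMap ℤ ℝ) by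
    have := ((hullBasis α).mem_span_iff_repr_mem ℤ _).mpr h
    rwa [span_range_hullBasis] at this
  intro i
  have h1 := congrArg (fun v => ((Int.castRingHom ℝ).mapMatrix (Matrix.of N)).adjugate.mulVec v i)
    hmul
  simp only [Matrix.mulVec_mulVec, Matrix.adjugate_mul, Matrix.smul_mulVec, Matrix.one_mulVec,
    hdet, Pi.smul_apply] at h1
  rw [map_smul, Finsupp.smul_apply, h1, ← RingHom.map_adjugate]
  exact ⟨(Matrix.of N).adjugate.mulVec m i, by
    simp [Matrix.mulVec, dotProduct]⟩

/-! ### Extrema over finitely many tuples of lattice points -/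

theorem finite_tuples {n : ℕ} (α : EuclideanSpace ℝ (Fin n)) (k : ℕ) (r : ℝ) :
    {x : Fin k → rationalHull α | ∀ i, x i ∈ hullLattice α ∧
      supNorm (x i : EuclideanSpace ℝ (Fin n)) ≤ r}.Finite :=
  Set.Finite.pi' fun _ => finite_hullLattice_supNorm_le α r

/-- Only finitely many tuples of lattice points compete for the infimum, so it is attained. -/
theorem isLeast_psi_of_nonempty {n : ℕ} (α : EuclideanSpace ℝ (Fin n)) (i₀ : Fin n) {k : ℕ}
    (hk : 1 ≤ k) {Q : ℝ} (hne : (psiSet α i₀ k Q).Nonempty) :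
    IsLeast (psiSet α i₀ k Q) (psi α i₀ k Q) := by
  obtain ⟨K₀, hK₀, x₀, hx₀, h₀⟩ := hne
  let f : (Fin k → rationalHull α) → ℝ := fun x =>
    ‖fun i => supNorm (x i : EuclideanSpace ℝ (Fin n))‖
  have hf : ∀ (x : Fin k → rationalHull α) (r : ℝ), 0 ≤ r →
      (f x ≤ r ↔ ∀ i, supNorm (x i : EuclideanSpace ℝ (Fin n)) ≤ r) := fun x r hr => by
    simp only [f, pi_norm_le_iff_of_nonneg hr, Real.norm_eq_abs, abs_of_nonneg (supNorm_nonneg _)]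
  obtain ⟨x, hx, hmin⟩ := Set.exists_min_image {x : Fin k → rationalHull α |
      LinearIndependent ℝ x ∧ ∀ i, x i ∈ hullLattice α ∧
        supNorm (x i : EuclideanSpace ℝ (Fin n)) ≤ K₀ ∧
        supNorm ((x i : EuclideanSpace ℝ (Fin n)) i₀ • α -
          α i₀ • (x i : EuclideanSpace ℝ (Fin n))) ≤ Q⁻¹} f
    ((finite_tuples α k K₀).subset fun x hx i => ⟨(hx.2 i).1, (hx.2 i).2.1⟩) ⟨x₀, hx₀, h₀⟩
  have hle := (hf x (f x) (norm_nonneg _)).mp le_rfl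
  have hpos : 0 < f x := by
    have h1 := one_le_supNorm α (hx.2 ⟨0, hk⟩).1 (hx.1.ne_zero _)
    linarith [hle ⟨0, hk⟩]
  have : IsLeast (psiSet α i₀ k Q) (f x) := by
    refine ⟨⟨hpos, x, hx.1, fun i => ⟨(hx.2 i).1, hle i, (hx.2 i).2.2⟩⟩, ?_⟩
    rintro K ⟨hK, y, hy, hyK⟩
    by_contra! hlt
    have hyf : f y ≤ K := (hf y K hK.le).mpr fun i => (hyK i).2.1
    have hxK : f x ≤ K₀ := (hf x K₀ hK₀.le).mpr fun i => (hx.2 i).2.1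
    have := hmin y ⟨hy, fun i => ⟨(hyK i).1, (hyK i).2.1.trans (hlt.le.trans hxK), (hyK i).2.2⟩⟩
    linarith
  rw [psi, this.csInf_eq]
  exact this

/-- Only finitely many tuples of lattice points compete for the supremum, so it is attained; it is
finite because no nonzero point of `Λ` is orthogonal to `α`. -/
theorem isGreatest_psiPrime_of_nonempty {n : ℕ} (α : EuclideanSpace ℝ (Fin n)) {k : ℕ}
    (hk : 1 ≤ k) {Q : ℝ} (hne : (psiPrimeSet α k Q).Nonempty) :
    IsGreatest (psiPrimeSet α k Q) (psiPrime α k Q) := by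
  obtain ⟨K₀, hK₀, x₀, hx₀, h₀⟩ := hne
  let f : (Fin k → rationalHull α) → ℝ := fun x =>
    ‖fun i => inner ℝ (x i : EuclideanSpace ℝ (Fin n)) α‖
  have hf : ∀ (x : Fin k → rationalHull α) (r : ℝ), 0 ≤ r →
      (f x ≤ r ↔ ∀ i, |inner ℝ (x i : EuclideanSpace ℝ (Fin n)) α| ≤ r) := fun x r hr => by
    simp only [f, pi_norm_le_iff_of_nonneg hr, Real.norm_eq_abs]
  obtain ⟨x, hx, hmin⟩ := Set.exists_min_image {x : Fin k → rationalHull α |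
      LinearIndependent ℝ x ∧ ∀ i, x i ∈ hullLattice α ∧
        supNorm (x i : EuclideanSpace ℝ (Fin n)) ≤ Q} f
    ((finite_tuples α k Q).subset fun x hx => hx.2) ⟨x₀, hx₀, fun i => ⟨(h₀ i).1, (h₀ i).2.1⟩⟩
  have hle := (hf x (f x) (norm_nonneg _)).mp le_rfl
  have hpos : 0 < f x := by
    have h1 := abs_pos.mpr (inner_ne_zero_of_mem_hullLattice α (hx.2 ⟨0, hk⟩).1 (hx.1.ne_zero _))
    linarith [hle ⟨0, hk⟩]
  have : IsGreatest (psiPrimeSet α k Q) (f x)⁻¹ := by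
    refine ⟨⟨inv_pos.mpr hpos, x, hx.1, fun i => ⟨(hx.2 i).1, (hx.2 i).2, ?_⟩⟩, ?_⟩
    · rw [inv_inv]; exact hle i
    · rintro K ⟨hK, y, hy, hyK⟩
      have hyf : f y ≤ K⁻¹ := (hf y K⁻¹ (by positivity)).mpr fun i => (hyK i).2.2
      rw [le_inv_comm₀ hK hpos]
      exact (hmin y ⟨hy, fun i => ⟨(hyK i).1, (hyK i).2.1⟩⟩).trans hyf
  rw [psiPrime, this.csSup_eq]
  exact this

theorem cPrime_spec {n : ℕ} (α : EuclideanSpace ℝ (Fin n)) {k : ℕ} (hkd : k ≤ effFreq α) :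
    1 ≤ cPrime α k ∧ ∃ x : Fin k → rationalHull α, LinearIndependent ℝ x ∧
      ∀ i, x i ∈ hullLattice α ∧
        supNorm (x i : EuclideanSpace ℝ (Fin n)) ≤ (cPrime α k : ℕ) := by
  refine Nat.sInf_mem (s := {q : ℕ | 1 ≤ q ∧ ∃ x : Fin k → rationalHull α,
    LinearIndependent ℝ x ∧
    ∀ i, x i ∈ hullLattice α ∧ supNorm (x i : EuclideanSpace ℝ (Fin n)) ≤ q}) ?_
  let x : Fin k → rationalHull α := hullBasis α ∘ Fin.castLE hkd
  obtain ⟨N, hN⟩ := exists_nat_ge ‖fun i => supNorm (x i : EuclideanSpace ℝ (Fin n))‖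
  refine ⟨N + 1, by omega, x, (hullBasis α).linearIndependent.comp _ (Fin.castLE_injective hkd),
    fun i => ⟨hullBasis_mem α _, ?_⟩⟩
  have h1 := norm_le_pi_norm (fun i => supNorm (x i : EuclideanSpace ℝ (Fin n))) i
  rw [Real.norm_of_nonneg (supNorm_nonneg _)] at h1
  push_cast
  linarith

theorem nonempty_psiPrimeSet {n : ℕ} (α : EuclideanSpace ℝ (Fin n)) {k : ℕ}
    (hkd : k ≤ effFreq α) {Q : ℝ} (hQ : (cPrime α k : ℝ) ≤ Q) :
    (psiPrimeSet α k Q).Nonempty := by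
  obtain ⟨-, x, hx, h⟩ := cPrime_spec α hkd
  set r := ‖fun i => inner ℝ (x i : EuclideanSpace ℝ (Fin n)) α‖
  refine ⟨(r + 1)⁻¹, by positivity, x, hx, fun i => ⟨(h i).1, (h i).2.trans hQ, ?_⟩⟩
  rw [inv_inv]
  have := norm_le_pi_norm (fun i => inner ℝ (x i : EuclideanSpace ℝ (Fin n)) α) i
  rw [Real.norm_eq_abs] at this
  linarith

/-! ### Transference for the hull lattice -/

/-- Transference for `C_K`: if no number below `K` belongs to `psiSet α i₀ k Q`, then `K / c` belongs
to `psiPrimeSet α (d + 1 - k) (2 * c * Q)`, where `c = (det Λ)² d! |α|`. This includes the case that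
`psiSet α i₀ k Q` is empty. -/
theorem exists_dual_vectors_of_lowerBound_psiSet {n : ℕ} {α : EuclideanSpace ℝ (Fin n)} (hα : α ≠ 0)
    {i₀ : Fin n} (hi₀ : |α i₀| = supNorm α) {k : ℕ} (hk1 : 1 ≤ k) (hkd : k ≤ effFreq α)
    {Q K : ℝ} (hQ : 0 < Q) (hK : 0 < K) (hQK : 1 ≤ 2 * supNorm α * Q * K)
    (hlow : K ∈ lowerBounds (psiSet α i₀ k Q)) {c : ℝ}
    (hc : c = latticeDet (hullLattice α) ^ 2 * ((effFreq α).factorial : ℝ) * supNorm α) :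
    ∃ y : Fin (effFreq α + 1 - k) → rationalHull α, LinearIndependent ℝ y ∧
      ∀ i, y i ∈ hullLattice α ∧
        supNorm (y i : EuclideanSpace ℝ (Fin n)) ≤ 2 * c * Q ∧
        |inner ℝ (y i : EuclideanSpace ℝ (Fin n)) α| ≤ c / K := by
  classical
  -- The unit ball of `p = max (|x| / K) (Q |x_{i₀} α - α_{i₀} x|)` is `C_K`.
  let T₁ : rationalHull α →ₗ[ℝ] (Fin n → ℝ) :=
    K⁻¹ • ((WithLp.linearEquiv 2 ℝ (Fin n → ℝ)).toLinearMap ∘ₗ (rationalHull α).subtype)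
  let T₂ : rationalHull α →ₗ[ℝ] (Fin n → ℝ) :=
    { toFun := fun x => Q • WithLp.ofLp ((x : EuclideanSpace ℝ (Fin n)) i₀ • α -
        α i₀ • (x : EuclideanSpace ℝ (Fin n)))
      map_add' := fun x y => by ext j; simp; ring
      map_smul' := fun r x => by ext j; simp; ring }
  let p : Seminorm ℝ (rationalHull α) :=
    (normSeminorm ℝ (Fin n → ℝ)).comp T₁ ⊔ (normSeminorm ℝ (Fin n → ℝ)).comp T₂
  have hp : ∀ x : rationalHull α, p x = max (K⁻¹ * supNorm (x : EuclideanSpace ℝ (Fin n)))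
      (Q * supNorm ((x : EuclideanSpace ℝ (Fin n)) i₀ • α -
        α i₀ • (x : EuclideanSpace ℝ (Fin n)))) := fun x => by
    have h1 : ‖T₁ x‖ = K⁻¹ * supNorm (x : EuclideanSpace ℝ (Fin n)) := by
      change ‖K⁻¹ • WithLp.ofLp (x : EuclideanSpace ℝ (Fin n))‖ = _
      rw [norm_smul, Real.norm_of_nonneg (by positivity)]
      rfl
    have h2 : ‖T₂ x‖ = Q * supNorm ((x : EuclideanSpace ℝ (Fin n)) i₀ • α -
        α i₀ • (x : EuclideanSpace ℝ (Fin n))) := by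
      change ‖Q • WithLp.ofLp ((x : EuclideanSpace ℝ (Fin n)) i₀ • α -
        α i₀ • (x : EuclideanSpace ℝ (Fin n)))‖ = _
      rw [norm_smul, Real.norm_of_nonneg hQ.le]
      rfl
    rw [← h1, ← h2]
    rfl
  have hple : ∀ x r, p x ≤ r → supNorm (x : EuclideanSpace ℝ (Fin n)) ≤ K * r := fun x r h => by
    rw [hp] at h
    have := (le_max_left _ _).trans h
    rwa [inv_mul_le_iff₀ hK] at this
  have hfin : ∀ r, {x | x ∈ Submodule.span ℤ (Set.range (hullBasis α)) ∧ p x ≤ r}.Finite :=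
    fun r => (finite_hullLattice_supNorm_le α (K * r)).subset fun x hx =>
      ⟨by rw [← span_range_hullBasis]; exact hx.1, hple x r hx.2⟩
  have hp0 : ∀ x, p x = 0 → x = 0 := fun x hx => by
    have h1 := hple x 0 hx.le
    rw [mul_zero] at h1
    exact Subtype.ext (supNorm_eq_zero.mp (le_antisymm h1 (supNorm_nonneg _)))
  obtain ⟨φ, hφ, h⟩ := exists_dual_lattice_vectors (hullBasis α) p hp0 hfin k hk1 hkd (by
    rintro ⟨x, hx, hxp⟩
    set r := ‖fun i => supNorm (x i : EuclideanSpace ℝ (Fin n))‖ with hr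
    have hle : ∀ i, supNorm (x i : EuclideanSpace ℝ (Fin n)) ≤ r := fun i => by
      have h1 := norm_le_pi_norm (fun i => supNorm (x i : EuclideanSpace ℝ (Fin n))) i
      rwa [Real.norm_of_nonneg (supNorm_nonneg _)] at h1
    have hmem : ∀ i, x i ∈ hullLattice α := fun i => by
      rw [← span_range_hullBasis]; exact (hxp i).1
    have hrK : r < K := by
      refine (pi_norm_lt_iff hK).mpr fun i => ?_
      have h1 := (hxp i).2
      rw [hp] at h1
      have := (le_max_left _ _).trans_lt h1
      rw [inv_mul_lt_iff₀ hK, mul_one] at this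
      rwa [Real.norm_of_nonneg (supNorm_nonneg _)]
    have hpos : 0 < r := by
      have h1 := one_le_supNorm α (hmem ⟨0, hk1⟩) (hx.ne_zero _)
      linarith [hle ⟨0, hk1⟩]
    refine absurd (hlow ⟨hpos, x, hx, fun i => ⟨hmem i, hle i, ?_⟩⟩) (not_le.mpr hrK)
    have h1 := (hxp i).2
    rw [hp] at h1
    have := (le_max_right _ _).trans h1.le
    rwa [← le_div_iff₀' hQ, one_div] at this)
  let R : (rationalHull α →ₗ[ℝ] ℝ) ≃ₗ[ℝ] rationalHull α :=
    LinearMap.toContinuousLinearMap.trans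
      (InnerProductSpace.toDual ℝ (rationalHull α)).symm.toLinearEquiv
  have hR : ∀ (ψ : rationalHull α →ₗ[ℝ] ℝ) x, inner ℝ (R ψ) x = ψ x := fun ψ x => by
    change inner ℝ ((InnerProductSpace.toDual ℝ (rationalHull α)).symm
      (LinearMap.toContinuousLinearMap ψ)) x = ψ x
    rw [InnerProductSpace.toDual_symm_apply]
    rfl
  set D := latticeDet (hullLattice α) with hD
  have hD0 : 0 < D := latticeDet_pos α
  have hα0 : 0 < supNorm α :=
    (supNorm_nonneg α).lt_of_ne' fun h => hα (supNorm_eq_zero.mp h)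
  let v : rationalHull α := ⟨α, (isLeast_rationalHull α).1.2⟩
  refine ⟨fun i => D ^ 2 • R (φ i), ?_, fun i => ⟨?_, ?_, ?_⟩⟩
  · exact (hφ.map' R.toLinearMap R.ker).units_smul fun _ => Units.mk0 _ (pow_pos hD0 2).ne'
  · refine latticeDet_sq_smul_mem α fun x hx => ?_
    rw [hR]
    exact (h i).1 x (by rw [span_range_hullBasis]; exact hx)
  · have hcoord : ∀ j, |(R (φ i) : EuclideanSpace ℝ (Fin n)) j| ≤
        (effFreq α).factorial * (2 * supNorm α * Q) := fun j => by
      -- The projection of a coordinate vector to `F` reads off a coordinate of vectors of `F`, and it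
      -- has `p w ≤ max K⁻¹ (2 |α| Q)`.
      let w := (rationalHull α).orthogonalProjectionOnto (EuclideanSpace.single j (1 : ℝ))
      have hw : (R (φ i) : EuclideanSpace ℝ (Fin n)) j = φ i w := by
        rw [← hR, Submodule.inner_orthogonalProjectionOnto_eq_of_mem_left,
          inner_eq_sum_mul]
        simp
      have hw1 : supNorm (w : EuclideanSpace ℝ (Fin n)) ≤ 1 := by
        refine (supNorm_le_norm _).trans ?_
        have := (rationalHull α).norm_orthogonalProjectionOnto_apply_le
          (EuclideanSpace.single j (1 : ℝ))
        rwa [PiLp.norm_single, norm_one, Submodule.coe_norm] at this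
      rw [hw]
      refine ((h i).2 w).trans (mul_le_mul_of_nonneg_left ?_ (by positivity))
      rw [hp]
      refine max_le ?_ ?_
      · rw [inv_mul_le_iff₀ hK]
        linarith
      · have h1 := supNorm_sub_le ((w : EuclideanSpace ℝ (Fin n)) i₀ • α)
          (α i₀ • (w : EuclideanSpace ℝ (Fin n)))
        rw [supNorm_smul, supNorm_smul, hi₀] at h1
        have h2 := (abs_apply_le_supNorm (w : EuclideanSpace ℝ (Fin n)) i₀).trans hw1
        nlinarith [mul_le_mul_of_nonneg_right h2 hα0.le, mul_le_mul_of_nonneg_left hw1 hα0.le]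
    rw [Submodule.coe_smul, supNorm_smul, abs_of_pos (by positivity)]
    have := (supNorm_le_iff (by positivity)).mpr hcoord
    calc D ^ 2 * supNorm (R (φ i) : EuclideanSpace ℝ (Fin n)) ≤
          D ^ 2 * ((effFreq α).factorial * (2 * supNorm α * Q)) := by gcongr
      _ = _ := by rw [hc]; ring
  · have h1 : inner ℝ ((D ^ 2 • R (φ i) : rationalHull α) : EuclideanSpace ℝ (Fin n)) α =
        D ^ 2 * φ i v := by
      rw [← hR, ← real_inner_smul_left]
      rfl
    have h2 : p v = K⁻¹ * supNorm α := by
      rw [hp]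
      have : supNorm ((v : EuclideanSpace ℝ (Fin n)) i₀ • α -
        α i₀ • (v : EuclideanSpace ℝ (Fin n))) = 0 := by
        rw [supNorm_eq_zero]; simp [v]
      rw [this, mul_zero]
      exact max_eq_left (by positivity)
    rw [h1, abs_mul, abs_of_pos (by positivity)]
    have h3 := (h i).2 v
    rw [h2] at h3
    calc D ^ 2 * |φ i v| ≤ D ^ 2 * ((effFreq α).factorial * (K⁻¹ * supNorm α)) := by gcongr
      _ = _ := by rw [hc]; ring

/-- If the set were empty, then for every large `K` there would be a nonzero `y ∈ Λ` with `|y|`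
bounded and `|y · α| ≤ c / K`; but only finitely many values `|y · α|`, all positive, can occur. -/
theorem nonempty_psiSet {n : ℕ} {α : EuclideanSpace ℝ (Fin n)} (hα : α ≠ 0)
    {i₀ : Fin n} (hi₀ : |α i₀| = supNorm α) {k : ℕ} (hk1 : 1 ≤ k) (hkd : k ≤ effFreq α)
    {Q : ℝ} (hQ : 0 < Q) : (psiSet α i₀ k Q).Nonempty := by
  by_contra hne
  rw [Set.not_nonempty_iff_eq_empty] at hne
  have hα0 : 0 < supNorm α :=
    (supNorm_nonneg α).lt_of_ne' fun h => hα (supNorm_eq_zero.mp h)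
  set c := latticeDet (hullLattice α) ^ 2 * ((effFreq α).factorial : ℝ) * supNorm α with hc
  have hc0 : 0 < c := by have := latticeDet_pos α; positivity
  let S := {y : rationalHull α | (y ∈ hullLattice α ∧
    supNorm (y : EuclideanSpace ℝ (Fin n)) ≤ 2 * c * Q) ∧ y ≠ 0}
  have hex : ∀ K, 0 < K → 1 ≤ 2 * supNorm α * Q * K →
      ∃ y ∈ S, |inner ℝ (y : EuclideanSpace ℝ (Fin n)) α| ≤ c / K := fun K hK hQK => by
    obtain ⟨y, hy, h⟩ := exists_dual_vectors_of_lowerBound_psiSet hα hi₀ hk1 hkd hQ hK hQK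
      (by rw [hne]; simp) hc
    let j : Fin (effFreq α + 1 - k) := ⟨0, by omega⟩
    exact ⟨y j, ⟨⟨(h j).1, (h j).2.1⟩, hy.ne_zero j⟩, (h j).2.2⟩
  have hQK : ∀ K, (2 * supNorm α * Q)⁻¹ ≤ K → 1 ≤ 2 * supNorm α * Q * K := fun K hK =>
    (inv_le_iff_one_le_mul₀' (by positivity)).mp hK
  have hSne : S.Nonempty := by
    obtain ⟨y, hy, -⟩ := hex (2 * supNorm α * Q)⁻¹ (by positivity) (hQK _ le_rfl)
    exact ⟨y, hy⟩
  obtain ⟨z, hz, hmin⟩ := Set.exists_min_image S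
    (fun y => |inner ℝ (y : EuclideanSpace ℝ (Fin n)) α|)
    ((finite_hullLattice_supNorm_le α (2 * c * Q)).subset fun y hy => hy.1) hSne
  have hz0 := abs_pos.mpr (inner_ne_zero_of_mem_hullLattice α hz.1.1 hz.2)
  set μ := |inner ℝ (z : EuclideanSpace ℝ (Fin n)) α|
  set K := max (2 * supNorm α * Q)⁻¹ (2 * c / μ) with hK
  have hK0 : 0 < K := lt_max_of_lt_left (by positivity)
  obtain ⟨y, hy, hyK⟩ := hex K hK0 (hQK _ (le_max_left _ _))
  have h1 := (hmin y hy).trans hyK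
  rw [le_div_iff₀ hK0] at h1
  have h2 : 2 * c / μ ≤ K := le_max_right _ _
  rw [div_le_iff₀ hz0] at h2
  linarith

/-! ### The two inequalities -/

/-- Two independent families with more than `dim E` members in all cannot be orthogonal. -/
theorem exists_inner_ne_zero {E : Type*} [NormedAddCommGroup E] [InnerProductSpace ℝ E]
    [FiniteDimensional ℝ E] {k m : ℕ} (hkm : finrank ℝ E < k + m) {x : Fin k → E} {y : Fin m → E}
    (hx : LinearIndependent ℝ x) (hy : LinearIndependent ℝ y) :
    ∃ i j, inner ℝ (x i) (y j) ≠ 0 := by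
  by_contra! h
  have hle : Submodule.span ℝ (Set.range y) ≤ (Submodule.span ℝ (Set.range x))ᗮ := by
    rw [Submodule.span_le]
    rintro _ ⟨j, rfl⟩
    rw [SetLike.mem_coe, Submodule.mem_orthogonal]
    intro u hu
    induction hu using Submodule.span_induction with
    | mem u hu => obtain ⟨i, rfl⟩ := hu; exact h i j
    | zero => simp
    | add u v _ _ hu hv => rw [inner_add_left, hu, hv, add_zero]
    | smul r u _ hu => rw [inner_smul_left, hu, mul_zero]
  have h1 := Submodule.finrank_mono hle
  have h2 := (Submodule.span ℝ (Set.range x)).finrank_add_finrank_orthogonal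
  rw [finrank_span_eq_card hx, Fintype.card_fin] at h2
  rw [finrank_span_eq_card hy, Fintype.card_fin] at h1
  omega

/-- The easy half of the duality: `c₁ K' ≤ K` for all `K ∈ psiSet` and `K' ∈ psiPrimeSet`, provided
that the two families of lattice points are large enough for a nonzero pairing. -/
theorem supNorm_mul_le_of_pairing {n : ℕ} {α : EuclideanSpace ℝ (Fin n)} {i₀ : Fin n}
    (hi₀ : |α i₀| = supNorm α) {k m : ℕ} (hkm : effFreq α < k + m) {Q K K' : ℝ} (hQ : 0 < Q)
    (hK : K ∈ psiSet α i₀ k Q) (hK' : K' ∈ psiPrimeSet α m (((n : ℝ) + 2)⁻¹ * supNorm α * Q)) :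
    ((n : ℝ) + 1)⁻¹ * supNorm α * K' ≤ K := by
  obtain ⟨hK0, x, hx, hxK⟩ := hK
  obtain ⟨hK'0, y, hy, hyK⟩ := hK'
  obtain ⟨i, j, hij⟩ := exists_inner_ne_zero hkm hx hy
  obtain ⟨a, ha⟩ := exists_int_inner_eq α (hxK i).1 (hyK j).1
  obtain ⟨-, hx1, hx2⟩ := hxK i
  obtain ⟨-, hy1, hy2⟩ := hyK j
  rw [Submodule.coe_inner] at hij
  set X := (x i : EuclideanSpace ℝ (Fin n))
  set Y := (y j : EuclideanSpace ℝ (Fin n))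
  have hone : 1 ≤ |inner ℝ X Y| := by
    rw [ha] at hij ⊢
    have : a ≠ 0 := by exact_mod_cast hij
    exact_mod_cast Int.one_le_abs this
  have hid : α i₀ * inner ℝ X Y = X i₀ * inner ℝ Y α - inner ℝ (X i₀ • α - α i₀ • X) Y := by
    rw [inner_sub_left, inner_smul_left, inner_smul_left, real_inner_comm α Y]
    simp
  have h1 : supNorm α ≤ K * K'⁻¹ + n * (Q⁻¹ * (((n : ℝ) + 2)⁻¹ * supNorm α * Q)) := by
    calc supNorm α ≤ supNorm α * |inner ℝ X Y| :=
          le_mul_of_one_le_right (supNorm_nonneg α) hone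
      _ = |X i₀ * inner ℝ Y α - inner ℝ (X i₀ • α - α i₀ • X) Y| := by rw [← hid, abs_mul, hi₀]
      _ ≤ |X i₀| * |inner ℝ Y α| + |inner ℝ (X i₀ • α - α i₀ • X) Y| := by
          rw [← abs_mul]; exact abs_sub _ _
      _ ≤ _ := by
          refine add_le_add ?_ ((abs_inner_le_supNorm _ _).trans ?_)
          · exact mul_le_mul ((abs_apply_le_supNorm X i₀).trans hx1) hy2 (abs_nonneg _) hK0.le
          · exact mul_le_mul_of_nonneg_left (mul_le_mul hx2 hy1 (supNorm_nonneg _)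
              (by positivity)) (by positivity)
  have h2 : (n : ℝ) * (Q⁻¹ * (((n : ℝ) + 2)⁻¹ * supNorm α * Q)) =
      n * supNorm α / (n + 2) := by field_simp
  rw [h2] at h1
  have hn : (0 : ℝ) ≤ n := Nat.cast_nonneg n
  have h3 : ((n : ℝ) + 1)⁻¹ * supNorm α ≤ supNorm α - n * supNorm α / (n + 2) := by
    have : supNorm α - n * supNorm α / (n + 2) - ((n : ℝ) + 1)⁻¹ * supNorm α =
      n * supNorm α / ((n + 1) * (n + 2)) := by field_simp; ring
    have : 0 ≤ n * supNorm α / (((n : ℝ) + 1) * (n + 2)) := by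
      have := supNorm_nonneg α
      positivity
    linarith
  have h4 : ((n : ℝ) + 1)⁻¹ * supNorm α ≤ K / K' := by rw [div_eq_mul_inv]; linarith
  rwa [le_div_iff₀ hK'0] at h4

end DioDuality

end

theorem theorem1 (n : ℕ) (hn : 2 ≤ n) (α : EuclideanSpace ℝ (Fin n)) (hα : α ≠ 0)
    (i₀ : Fin n) (hi₀ : |α i₀| = DioDuality.supNorm α)
    (k : ℕ) (hk1 : 1 ≤ k) (hkd : k ≤ DioDuality.effFreq α) :
    -- `Ψ_k(Q)` is well defined, attained and positive for every `Q ≥ 1`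
    (∀ Q : ℝ, 1 ≤ Q →
      IsLeast (DioDuality.psiSet α i₀ k Q) (DioDuality.psi α i₀ k Q)) ∧
    -- `Ψ'_k(Q)` is well defined and attained for every `Q ≥ C'_k`
    (∀ Q : ℝ, (DioDuality.cPrime α k : ℝ) ≤ Q →
      IsGreatest (DioDuality.psiPrimeSet α k Q) (DioDuality.psiPrime α k Q)) ∧
    -- the two inequalities; the threshold `Q₀` may be taken with `C'_k` or with `C'_{d+1-k}`
    ∀ (j : ℕ) (c₁ c₂ c₃ c₄ Q₀ : ℝ),
      j = k ∨ j = DioDuality.effFreq α + 1 - k →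
      c₁ = ((n : ℝ) + 1)⁻¹ * DioDuality.supNorm α →
      c₂ = ((n : ℝ) + 2)⁻¹ * DioDuality.supNorm α →
      c₃ = DioDuality.latticeDet (DioDuality.hullLattice α) ^ 2 *
        ((DioDuality.effFreq α).factorial : ℝ) * DioDuality.supNorm α →
      c₄ = 2 * c₃ →
      Q₀ = max 1 (((n : ℝ) + 2) * (DioDuality.cPrime α j : ℝ) * (DioDuality.supNorm α)⁻¹) →
      ∀ Q : ℝ, Q₀ ≤ Q →
        c₁ * DioDuality.psiPrime α (DioDuality.effFreq α + 1 - k) (c₂ * Q) ≤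
            DioDuality.psi α i₀ k Q ∧
          DioDuality.psi α i₀ k Q ≤
            c₃ * DioDuality.psiPrime α (DioDuality.effFreq α + 1 - k) (c₄ * Q) := by
  have hα0 : 0 < DioDuality.supNorm α :=
    (DioDuality.supNorm_nonneg α).lt_of_ne' fun h => hα (DioDuality.supNorm_eq_zero.mp h)
  have hpsi : ∀ Q : ℝ, 0 < Q →
      IsLeast (DioDuality.psiSet α i₀ k Q) (DioDuality.psi α i₀ k Q) := fun Q hQ =>
    DioDuality.isLeast_psi_of_nonempty α i₀ hk1 (DioDuality.nonempty_psiSet hα hi₀ hk1 hkd hQ)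
  refine ⟨fun Q hQ => hpsi Q (by linarith), fun Q hQ =>
    DioDuality.isGreatest_psiPrime_of_nonempty α hk1 (DioDuality.nonempty_psiPrimeSet α hkd hQ), ?_⟩
  rintro j c₁ c₂ c₃ c₄ Q₀ hj rfl rfl hc₃ rfl rfl Q hQ
  have hQ1 : 1 ≤ Q := (le_max_left _ _).trans hQ
  have hQ0 : 0 < Q := by linarith
  obtain ⟨⟨hK0, x, hx, hxK⟩, hlow⟩ := hpsi Q hQ0
  set K := DioDuality.psi α i₀ k Q
  have hm1 : 1 ≤ DioDuality.effFreq α + 1 - k := by omega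
  constructor
  · rcases Set.eq_empty_or_nonempty (DioDuality.psiPrimeSet α (DioDuality.effFreq α + 1 - k)
      (((n : ℝ) + 2)⁻¹ * DioDuality.supNorm α * Q)) with he | hne
    · rw [DioDuality.psiPrime, he, Real.sSup_empty, mul_zero]
      exact hK0.le
    · exact DioDuality.supNorm_mul_le_of_pairing hi₀ (by omega) hQ0 (hpsi Q hQ0).1
        (DioDuality.isGreatest_psiPrime_of_nonempty α hm1 hne).1
  · have hc0 : 0 < c₃ := by
      have := DioDuality.latticeDet_pos α
      rw [hc₃]
      positivity
    have hK1 : 1 ≤ K :=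
      (DioDuality.one_le_supNorm α (hxK ⟨0, hk1⟩).1 (hx.ne_zero _)).trans (hxK ⟨0, hk1⟩).2.1
    have hC : (1 : ℝ) ≤ DioDuality.cPrime α j := by
      have : j ≤ DioDuality.effFreq α := by omega
      exact_mod_cast (DioDuality.cPrime_spec α this).1
    have hαQ : 1 ≤ DioDuality.supNorm α * Q := by
      have h1 := (le_max_right _ _).trans hQ
      rw [← div_eq_mul_inv, div_le_iff₀' hα0] at h1
      have hn0 : (0 : ℝ) ≤ n := Nat.cast_nonneg n
      nlinarith
    obtain ⟨y, hy, h⟩ := DioDuality.exists_dual_vectors_of_lowerBound_psiSet hα hi₀ hk1 hkd hQ0 hK0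
      (by nlinarith) hlow hc₃
    have hmem : K / c₃ ∈ DioDuality.psiPrimeSet α (DioDuality.effFreq α + 1 - k)
        (2 * c₃ * Q) :=
      ⟨by positivity, y, hy, fun i => ⟨(h i).1, (h i).2.1, by rw [inv_div]; exact (h i).2.2⟩⟩
    have h1 := (DioDuality.isGreatest_psiPrime_of_nonempty α hm1 ⟨_, hmem⟩).2 hmem
    rwa [div_le_iff₀' hc0] at h1
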